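/- Let $\mathcal P$ be the set of primes and let $$\mathcal A=\prod_{p\in\mathcal P}(\mathbb Z/p\mathbb Z)\Big/\bigoplus_{p\in\mathcal P}(\mathbb Z/p\mathbb Z),$$ a $\mathbb Q$-algebra in which elements may be specified by their components at all but finitely many primes. Let $\mathbb D=\mathbb N\cup\overline{\mathbb N}$ consist of the positive integers $s$ and the barred positive integers $\bar s$, with $\operatorname{sgn}(s)=1$, $\operatorname{sgn}(\bar s)=-1$ and $|s|=|\bar s|=s$. For $s_1,\dots,s_d\in\mathbb D$ define the finite Euler sum, of weight $|s_1|+\cdots+|s_d|$, by $$\zeta_{\mathcal A}(s_1,\dots,s_d)=\Big(\sum_{p>n_1>\cdots>n_d>0}\ \prod_{j=1}^d\frac{\operatorname{sgn}(s_j)^{n_j}}{n_j^{|s_j|}}\bmod p\Big)_{p\in\mathcal P}\in\mathcal A .$$ Let $$q_2=\Big(\frac{2^{p-1}-1}{p}\bmod p\Big)_{p\ge 3},\qquad \beta_w=\Big(\frac{B_{p-w}}{w}\bmod p\Big)_{p>w}\quad (w\ge 2)$$ in $\mathcal A$, where the Bernoulli numbers are given by $\frac{t}{e^t-1}=\sum_{n\ge0}B_n\frac{t^n}{n!}$.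 **Theorem.** For $w\ge 1$ let $\mathsf{FES}_w\subseteq\mathcal A$ be the $\mathbb Q$-vector space generated by all finite Euler sums of weight $w$. Then, with $\langle\cdots\rangle$ denoting the $\mathbb Q$-linear span, $$\begin{aligned} \mathsf{FES}_1&=\langle q_2\rangle,\qquad \mathsf{FES}_2=\langle q_2^2\rangle,\qquad \mathsf{FES}_3=\langle q_2^3,\ \beta_3\rangle,\qquad \mathsf{FES}_4=\langle q_2^4,\ q_2\beta_3,\ \zeta_{\mathcal A}(1,\bar3)\rangle,\\ \mathsf{FES}_5&=\langle q_2^5,\ q_2^2\beta_3,\ \beta_5,\ \zeta_{\mathcal A}(\bar1,2,2),\ \zeta_{\mathcal A}(\bar1,\bar2,2)\rangle,\\ \mathsf{FES}_6&=\langle q_2^6,\ q_2^3\beta_3,\ \beta_3^2,\ q_2\beta_5,\ \zeta_{\mathcal A}(\bar1,1,2,2),\ \zeta_{\mathcal A}(\bar1,2,2,1),\ \zeta_{\mathcal A}(\bar1,2,1,2),\ \zeta_{\mathcal A}(\bar1,1,1,1,2)\rangle . \end{aligned}$$ -/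

import Mathlib

namespace FiniteEuler

/-- The ideal `⨁_p ℤ/pℤ` of `∏_p ℤ/pℤ` (`p` running over all primes): the families having
only finitely many nonzero components. -/
def finSuppIdeal : Ideal (∀ p : Nat.Primes, ZMod (p : ℕ)) where
  carrier := {x | {p | x p ≠ 0}.Finite}
  zero_mem' := by simp
  add_mem' := by
    intro a b ha hb
    refine (Set.Finite.union ha hb).subset ?_
    intro p hp
    by_contra h
    simp only [Set.mem_union, Set.mem_ofPred_eq, not_or, not_not] at h
    exact hp (by simp [h.1, h.2])
  smul_mem' := by
    intro c x hx
    refine Set.Finite.subset hx ?_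
    intro p hp h
    exact hp (by simp [h])

/-- The ring `𝒜 = (∏_p ℤ/pℤ) / (⨁_p ℤ/pℤ)`. -/
abbrev 𝒜 : Type := (∀ p : Nat.Primes, ZMod (p : ℕ)) ⧸ finSuppIdeal

/-- The class in `𝒜` of a family of residues. -/
def 𝒜.of (x : ∀ p : Nat.Primes, ZMod (p : ℕ)) : 𝒜 := Ideal.Quotient.mk finSuppIdeal x

/-- Two families define the same element of `𝒜` as soon as they agree at all primes outside
of a finite set. -/
theorem 𝒜.of_eq_of_finite {x y : ∀ p : Nat.Primes, ZMod (p : ℕ)} (S : Set Nat.Primes)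
    (hS : S.Finite) (h : ∀ p ∉ S, x p = y p) : 𝒜.of x = 𝒜.of y := by
  refine Ideal.Quotient.eq.2 (hS.subset ?_)
  intro p hp
  by_contra hpS
  exact hp (by simp [h p hpS])

theorem finite_primes_dvd (n : ℕ) (hn : n ≠ 0) :
    {p : Nat.Primes | (p : ℕ) ∣ n}.Finite := by
  refine Set.Finite.of_finite_image (f := fun p : Nat.Primes => (p : ℕ)) ?_
    (fun a _ b _ h => Subtype.ext h)
  refine (Set.finite_Iic n).subset ?_
  rintro _ ⟨p, hp, rfl⟩
  exact Nat.le_of_dvd (Nat.pos_of_ne_zero hn) hp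

/-- The ring homomorphism `ℚ → 𝒜`, sending `r` to the class of `(r mod p)_p`; the component
`r mod p` is meaningful for all `p` not dividing the denominator of `r`. -/
def ratHom : ℚ →+* 𝒜 where
  toFun r := 𝒜.of fun p => haveI := Fact.mk p.2; ((r : ℚ) : ZMod (p : ℕ))
  map_zero' := by
    refine 𝒜.of_eq_of_finite (y := 0) ∅ Set.finite_empty fun p _ => ?_
    have := Fact.mk p.2
    simp
  map_one' := by
    refine 𝒜.of_eq_of_finite (y := 1) ∅ Set.finite_empty fun p _ => ?_
    have := Fact.mk p.2
    simp
  map_add' := by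
    intro a b
    refine 𝒜.of_eq_of_finite (y := (fun p => _) + (fun p => _)) _
      ((finite_primes_dvd a.den a.den_nz).union (finite_primes_dvd b.den b.den_nz))
      fun p hp => ?_
    have := Fact.mk p.2
    simp only [Set.mem_union, Set.mem_ofPred_eq, not_or] at hp
    exact Rat.cast_add_of_ne_zero
      (by rw [Ne, ZMod.natCast_eq_zero_iff]; exact hp.1)
      (by rw [Ne, ZMod.natCast_eq_zero_iff]; exact hp.2)
  map_mul' := by
    intro a b
    refine 𝒜.of_eq_of_finite (y := (fun p => _) * (fun p => _)) _
      ((finite_primes_dvd a.den a.den_nz).union (finite_primes_dvd b.den b.den_nz))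
      fun p hp => ?_
    have := Fact.mk p.2
    simp only [Set.mem_union, Set.mem_ofPred_eq, not_or] at hp
    exact Rat.cast_mul_of_ne_zero
      (by rw [Ne, ZMod.natCast_eq_zero_iff]; exact hp.1)
      (by rw [Ne, ZMod.natCast_eq_zero_iff]; exact hp.2)

/-- `𝒜` is a `ℚ`-algebra (in the only possible way). -/
instance instAlgebraRat : Algebra ℚ 𝒜 := ratHom.toAlgebra

/-- The set `𝔻` of positive integers `s` and barred positive integers `s̄`. -/
inductive SignedIndex where
  | pos (s : ℕ+)
  | bar (s : ℕ+)

namespace SignedIndex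

/-- `sgn s = 1` and `sgn s̄ = -1`. -/
def sgn : SignedIndex → ℤ
  | pos _ => 1
  | bar _ => -1

/-- `|s| = |s̄| = s`. -/
def abs : SignedIndex → ℕ
  | pos s => s
  | bar s => s

end SignedIndex

/-- The weight `|s₁| + ⋯ + |s_d|` of `(s₁, …, s_d)`. -/
def weight (s : List SignedIndex) : ℕ := (s.map SignedIndex.abs).sum

/-- The nested sum `∑_{N > n₁ > ⋯ > n_d > 0} ∏_j sgn(s_j)^{n_j} / n_j^{|s_j|}`, with values in a
field `K`, obtained by summing over `n₁` last. It is used for `K = ℤ/pℤ` and `N = p`, where all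
denominators are invertible. -/
def eulerPartialSum (K : Type) [Field K] : List SignedIndex → ℕ → K
  | [], _ => 1
  | s :: t, N => ∑ n ∈ Finset.Ico 1 N,
      ((s.sgn : K) ^ n / (n : K) ^ s.abs) * eulerPartialSum K t n

/-- The finite Euler sum `ζ_𝒜(s₁, …, s_d)`. -/
def zetaA (s : List SignedIndex) : 𝒜 :=
  𝒜.of fun p => haveI := Fact.mk p.2; eulerPartialSum (ZMod (p : ℕ)) s p

/-- The `ℚ`-linear span in `𝒜` of all finite Euler sums of weight `w`. -/
def FES (w : ℕ) : Submodule ℚ 𝒜 :=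
  Submodule.span ℚ {x | ∃ s : List SignedIndex, weight s = w ∧ x = zetaA s}

/-- The Fermat quotient `q₂ = ((2^(p-1) - 1) / p mod p)_{p ≥ 3}`; the division is exact. -/
def q₂ : 𝒜 :=
  𝒜.of fun p => if 3 ≤ (p : ℕ) then (((2 ^ ((p : ℕ) - 1) - 1) / (p : ℕ) : ℕ) : ZMod (p : ℕ)) else 0

/-- `β_w = (B_{p-w} / w mod p)_{p > w}`, where `B_n` are the Bernoulli numbers given by
`t / (e^t - 1) = ∑ B_n t^n / n!`. -/
def β (w : ℕ) : 𝒜 :=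
  𝒜.of fun p => haveI := Fact.mk p.2
    if w < (p : ℕ) then ((bernoulli ((p : ℕ) - w) / (w : ℚ) : ℚ) : ZMod (p : ℕ)) else 0

end FiniteEuler

namespace FiniteEuler

/-! ### Words

The index of absolute value `a / 2 + 1` and sign `(-1) ^ a` is coded by the natural number `a`. -/

/-- The code of the index whose absolute value is the sum of the absolute values and whose sign is the
product of the signs. -/
def mergeLetter (a b : ℕ) : ℕ := 2 * (a / 2 + b / 2 + 1) + (a + b) % 2

def stuffleAux (a : ℕ) (u : List ℕ) (f : List ℕ → List (List ℕ)) : List ℕ → List (List ℕ)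
  | [] => [a :: u]
  | b :: v => (f (b :: v)).map (a :: ·) ++ ((stuffleAux a u f v).map (b :: ·) ++
      (f v).map (mergeLetter a b :: ·))

/-- The words, with multiplicity, of the stuffle product of two words. -/
def stuffle : List ℕ → List ℕ → List (List ℕ)
  | [] => fun v => [v]
  | a :: u => stuffleAux a u (stuffle u)

def shuffleAux (a : ℕ) (u : List ℕ) (f : List ℕ → List (List ℕ)) : List ℕ → List (List ℕ)
  | [] => [a :: u]
  | b :: v => (f (b :: v)).map (a :: ·) ++ (shuffleAux a u f v).map (b :: ·)

/-- The words, with multiplicity, of the shuffle product of two words. -/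
def shuffle : List ℕ → List ℕ → List (List ℕ)
  | [] => fun v => [v]
  | a :: u => shuffleAux a u (shuffle u)

/-- The iterated integral attached to a word: the letter `0` stands for `dt / t`, and the letters `2`
and `3` for `dt / (1 - t)` and `-dt / (1 + t)`. The parity of `b` is the sign to start from. -/
def toLetters : ℕ → List ℕ → List ℕ
  | _, [] => []
  | b, a :: t => List.replicate (a / 2) 0 ++ ((b + a) % 2 + 2) :: toLetters (b + a) t

/-- The word attached to an iterated integral preceded by `s` letters `0`. -/
def ofLetters : ℕ → ℕ → List ℕ → List ℕ
  | _, _, [] => []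
  | b, s, 0 :: l => ofLetters b (s + 1) l
  | b, s, (x + 1) :: l => (2 * s + (x + 1 + b) % 2) :: ofLetters (x + 1) 0 l

/-- The shuffle product of two words, through their iterated integrals. -/
def shuffleWords (u v : List ℕ) : List (List ℕ) :=
  (shuffle (toLetters 0 u) (toLetters 0 v)).map (ofLetters 0 0)

/-- The substitution `n ↦ p - n` multiplies the summand of `u` by `(-1) ^ reflExponent u`. -/
def reflExponent (u : List ℕ) : ℕ := u.foldr (fun a n => a / 2 + 1 + a + n) 0

/-- The words, with multiplicity, of a product of words. -/
def stuffleProd : List (List ℕ) → List (List ℕ)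
  | [] => [[]]
  | w :: t => (stuffleProd t).flatMap (stuffle w)

/-- The words of weight `n`. -/
def words : ℕ → List (List ℕ)
  | 0 => [[]]
  | n + 1 => (words n).flatMap fun
    | [] => [[0], [1]]
    | a :: t => [0 :: a :: t, 1 :: a :: t, (a + 2) :: t]

/-- An injective coding of words. -/
def wordKey : List ℕ → ℕ
  | [] => 0
  | a :: t => 4 ^ (a / 2) * ((2 - a % 2) + 4 * wordKey t)

/-! ### Elimination

The definitions of this section are written for evaluation by the kernel: they use recursors, the
accelerated operations on `ℕ`, and continuations to control the order of evaluation. -/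

/-- A linear combination of keys: the entry `(k, x, y)` is `x - y` times the key `k`. -/
abbrev Row := List (ℕ × ℕ × ℕ)

noncomputable def consTerm (k x y : ℕ) (r : Row) : Row :=
  Nat.casesOn (Nat.sub x y) (Nat.casesOn (Nat.sub y x) r fun m => (k, 0, m.succ) :: r)
    fun m => (k, m.succ, 0) :: r

noncomputable def addTerm (k x y : ℕ) (s : Row) : Row :=
  List.rec [(k, x, y)] (fun t s ih => Bool.casesOn (Nat.ble t.1 k) (t :: ih)
    (Bool.casesOn (Nat.ble k t.1) ((k, x, y) :: t :: s)
      (consTerm k (Nat.add x t.2.1) (Nat.add y t.2.2) s))) s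

noncomputable def scaleRow (c d : ℕ) (s : Row) : Row :=
  List.rec [] (fun t _ ih => consTerm t.1 (Nat.add (Nat.mul c t.2.1) (Nat.mul d t.2.2))
    (Nat.add (Nat.mul c t.2.2) (Nat.mul d t.2.1)) ih) s

noncomputable def combineAux (a c d k x y : ℕ) (f : Row → Row) (s : Row) : Row :=
  List.rec (consTerm k (Nat.mul a x) (Nat.mul a y) (f []))
    (fun t s ih => Bool.casesOn (Nat.ble t.1 k)
      (consTerm t.1 (Nat.add (Nat.mul c t.2.1) (Nat.mul d t.2.2))
        (Nat.add (Nat.mul c t.2.2) (Nat.mul d t.2.1)) ih)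
      (Bool.casesOn (Nat.ble k t.1) (consTerm k (Nat.mul a x) (Nat.mul a y) (f (t :: s)))
        (consTerm k (Nat.add (Nat.mul a x) (Nat.add (Nat.mul c t.2.1) (Nat.mul d t.2.2)))
          (Nat.add (Nat.mul a y) (Nat.add (Nat.mul c t.2.2) (Nat.mul d t.2.1))) (f s)))) s

/-- The linear combination `a * r + (c - d) * s`, for rows sorted by decreasing keys. -/
noncomputable def combine (a c d : ℕ) (r : Row) : Row → Row :=
  List.rec (scaleRow c d) (fun t _ ih => combineAux a c d t.1 t.2.1 t.2.2 ih) r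

/-- Evaluates `f r` after having evaluated `r`. -/
noncomputable def forceRow {α : Type} (f : Row → α) (r : Row) : α :=
  List.rec (fun f => f []) (fun t _ ih f => ih fun s => f (t :: s)) r f

/-- Evaluates `f n` after having evaluated `n`. -/
noncomputable def forceNat {α : Type} (f : ℕ → α) (n : ℕ) : α :=
  Nat.casesOn n (f 0) fun m => f m.succ

/-- Eliminates the leading term `t'` of `r` by means of the row `s` with leading term `t`. -/
noncomputable def cancelLeading (t t' : ℕ × ℕ × ℕ) (r s : Row) : Row :=
  (fun g => combine (Nat.div (Nat.add t.2.1 t.2.2) g)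
      (Nat.div (Nat.add (Nat.mul t'.2.1 (Nat.sub 1 t.2.1)) (Nat.mul t'.2.2 (Nat.sub 1 t.2.2))) g)
      (Nat.div (Nat.add (Nat.mul t'.2.1 (Nat.sub 1 t.2.2)) (Nat.mul t'.2.2 (Nat.sub 1 t.2.1))) g)
      r s) (Nat.gcd (Nat.add t.2.1 t.2.2) (Nat.add t'.2.1 t'.2.2))

/-- Reduces the row `r` by the rows of `T`, which have decreasing leading keys, and inserts it. -/
noncomputable def insertRow {α : Type} (T : List Row) : Row → (List Row → α) → α :=
  List.rec
    (fun r f => List.casesOn r (f []) fun x r' => forceRow (fun s => f [s]) (x :: r'))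
    (fun R T ih r f => List.casesOn R (ih r f) fun t _ =>
      List.casesOn r (f (R :: T)) fun t' _ =>
        Bool.casesOn (Nat.ble t.1 t'.1)
          (ih r fun T' => f (R :: T'))
          (Bool.casesOn (Nat.ble t'.1 t.1) (forceRow (fun s' => f (s' :: R :: T)) r)
            (ih (cancelLeading t t' r R) fun T' => f (R :: T')))) T

noncomputable def insertRows {α β : Type} (row : β → Row) (f : List Row → α) :
    List β → List Row → α
  | [], T => f T
  | d :: L, T => insertRow T (row d) (insertRows row f L)

/-- The set, coded as a bit mask, of the keys shown to vanish by back substitution. -/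
noncomputable def solvedMask {α : Type} (f : ℕ → α) : List Row → α
  | [] => f 0
  | [] :: T => solvedMask f T
  | ((k, x, y) :: s) :: T => solvedMask (fun m =>
      bif s.all (fun t => m.testBit t.1) && !(Nat.beq x y) then forceNat f (m ||| 2 ^ k) else f m) T

noncomputable def addWords (x y : ℕ) (W : List (List ℕ)) (r : Row) : Row :=
  W.foldr (fun w r => addTerm (wordKey w) x y r) r

/-- The shuffle relation for `u` and `v`, multiplied by `z`, where `d = (z, u, v)`. -/
noncomputable def relationRow (d : List ℕ × List ℕ × List ℕ) : Row :=
  addWords 1 0 ((shuffleWords d.2.1 d.2.2).flatMap (stuffle d.1))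
    (addWords (reflExponent d.2.1 % 2) (1 - reflExponent d.2.1 % 2)
      (stuffle d.1 (d.2.1.reverseAux d.2.2)) [])

noncomputable def productRow (W : List (List ℕ)) : Row := addWords 1 0 (stuffleProd W) []

/-- Whether the relations `R` express all words of weight `n` through the products in `T`. -/
noncomputable def checkSpan (n : ℕ) (T : List (List (List ℕ)))
    (R : List (List ℕ × List ℕ × List ℕ)) : Bool :=
  insertRows productRow
    (insertRows relationRow (solvedMask fun m => (words n).all fun w => m.testBit (wordKey w)) R)
    T []

theorem wordKey_injective : Function.Injective wordKey := by
  have aux : ∀ a b d e m n : ℕ, 0 < d → d < 4 → 0 < e → e < 4 →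
      4 ^ a * (d + 4 * m) = 4 ^ b * (e + 4 * n) → a = b ∧ d = e ∧ m = n := by
    intro a
    induction a with
    | zero =>
      intro b d e m n _ _ _ _ h
      cases b with
      | zero => simp at h; omega
      | succ b => rw [pow_succ, mul_comm (4 ^ b), mul_assoc] at h; omega
    | succ a ih =>
      intro b d e m n hd hd' he he' h
      cases b with
      | zero => rw [pow_succ, mul_comm (4 ^ a), mul_assoc] at h; omega
      | succ b =>
        rw [pow_succ, pow_succ, mul_comm (4 ^ a), mul_comm (4 ^ b), mul_assoc, mul_assoc] at h
        obtain ⟨h1, h2⟩ := ih b d e m n hd hd' he he' (by omega)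
        exact ⟨by omega, h2⟩
  have hpos : ∀ a t, wordKey (a :: t) ≠ 0 := fun a t => by
    have : 0 < 4 ^ (a / 2) := by positivity
    have : 0 < (2 - a % 2) + 4 * wordKey t := by omega
    simp only [wordKey]
    positivity
  intro u
  induction u with
  | nil =>
    rintro (_ | ⟨b, v⟩) h
    · rfl
    · exact absurd h.symm (hpos b v)
  | cons a u ih =>
    rintro (_ | ⟨b, v⟩) h
    · exact absurd h (hpos a u)
    · obtain ⟨h1, h2, h3⟩ := aux (a / 2) (b / 2) _ _ _ _ (by omega) (by omega) (by omega)
        (by omega) h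
      rw [ih h3, show a = b by omega]

section Soundness

variable {M : Type} [AddCommGroup M] (g : ℕ → M)

/-- The value of a row when the keys are given values in an abelian group. -/
def Row.eval (r : Row) : M := (r.map fun t => ((t.2.1 : ℤ) - t.2.2) • g t.1).sum

@[simp] theorem Row.eval_nil : Row.eval g [] = 0 := rfl

@[simp] theorem Row.eval_cons (t : ℕ × ℕ × ℕ) (r : Row) :
    Row.eval g (t :: r) = ((t.2.1 : ℤ) - t.2.2) • g t.1 + Row.eval g r := by
  simp [Row.eval]

theorem Row.eval_consTerm (k x y : ℕ) (r : Row) :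
    Row.eval g (consTerm k x y r) = ((x : ℤ) - y) • g k + Row.eval g r := by
  have h : ((x : ℤ) - y) = ((x - y : ℕ) : ℤ) - ((y - x : ℕ) : ℤ) := by omega
  unfold consTerm
  rw [h]
  change Row.eval g (Nat.casesOn (x - y) (Nat.casesOn (y - x) _ _) _) = _
  rcases hx : x - y with _ | m
  · rcases hy : y - x with _ | n <;> simp
  · have hy : y - x = 0 := by omega
    simp [hy]

theorem Row.eval_addTerm (k x y : ℕ) (s : Row) :
    Row.eval g (addTerm k x y s) = ((x : ℤ) - y) • g k + Row.eval g s := by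
  induction s with
  | nil => simp [addTerm]
  | cons t s ih =>
    change Row.eval g (Bool.casesOn (Nat.ble t.1 k) (t :: addTerm k x y s)
      (Bool.casesOn (Nat.ble k t.1) ((k, x, y) :: t :: s) (consTerm k (x + t.2.1) (y + t.2.2) s))) = _
    rcases h : Nat.ble t.1 k
    · simp only [Row.eval_cons, ih]; abel
    · rcases h' : Nat.ble k t.1
      · simp
      · have e : t.1 = k := le_antisymm (Nat.le_of_ble_eq_true h) (Nat.le_of_ble_eq_true h')
        simp only [Row.eval_consTerm, Row.eval_cons, e]
        push_cast
        module

theorem Row.eval_scaleRow (c d : ℕ) (s : Row) :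
    Row.eval g (scaleRow c d s) = ((c : ℤ) - d) • Row.eval g s := by
  induction s with
  | nil => simp [scaleRow]
  | cons t s ih =>
    change Row.eval g (consTerm t.1 (c * t.2.1 + d * t.2.2) (c * t.2.2 + d * t.2.1)
      (scaleRow c d s)) = _
    rw [Row.eval_consTerm, ih, Row.eval_cons]
    push_cast
    module

theorem Row.eval_combine (a c d : ℕ) (r s : Row) :
    Row.eval g (combine a c d r s) = (a : ℤ) • Row.eval g r + ((c : ℤ) - d) • Row.eval g s := by
  induction r generalizing s with
  | nil =>
    change Row.eval g (scaleRow c d s) = _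
    rw [Row.eval_scaleRow]; simp
  | cons t r ih =>
    obtain ⟨k, x, y⟩ := t
    change Row.eval g (combineAux a c d k x y (combine a c d r) s) = _
    induction s with
    | nil =>
      change Row.eval g (consTerm k (a * x) (a * y) (combine a c d r [])) = _
      rw [Row.eval_consTerm, ih, Row.eval_cons, Row.eval_nil]
      push_cast
      module
    | cons t s ihs =>
      change Row.eval g (Bool.casesOn (Nat.ble t.1 k)
        (consTerm t.1 (c * t.2.1 + d * t.2.2) (c * t.2.2 + d * t.2.1)
          (combineAux a c d k x y (combine a c d r) s))
        (Bool.casesOn (Nat.ble k t.1) (consTerm k (a * x) (a * y) (combine a c d r (t :: s)))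
          (consTerm k (a * x + (c * t.2.1 + d * t.2.2)) (a * y + (c * t.2.2 + d * t.2.1))
            (combine a c d r s)))) = _
      rcases h : Nat.ble t.1 k
      · simp only [Row.eval_consTerm, ihs, Row.eval_cons]
        push_cast
        module
      · rcases h' : Nat.ble k t.1
        · simp only [Row.eval_consTerm, ih, Row.eval_cons]
          push_cast
          module
        · have e : t.1 = k := le_antisymm (Nat.le_of_ble_eq_true h) (Nat.le_of_ble_eq_true h')
          simp only [Row.eval_consTerm, ih, Row.eval_cons, e]
          push_cast
          module

theorem Row.eval_cancelLeading {t t' : ℕ × ℕ × ℕ} {r s : Row} (hr : Row.eval g r = 0)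
    (hs : Row.eval g s = 0) : Row.eval g (cancelLeading t t' r s) = 0 := by
  rw [cancelLeading, Row.eval_combine, hr, hs, smul_zero, smul_zero, add_zero]

theorem Row.eval_addWords (x y : ℕ) (W : List (List ℕ)) (r : Row) :
    Row.eval g (addWords x y W r) =
      ((x : ℤ) - y) • (W.map fun w => g (wordKey w)).sum + Row.eval g r := by
  induction W with
  | nil => simp [addWords]
  | cons w W ih =>
    change Row.eval g (addTerm _ x y (addWords x y W r)) = _
    rw [Row.eval_addTerm, ih, List.map_cons, List.sum_cons, smul_add, add_assoc]

theorem forceRow_eq {α : Type} (f : Row → α) (r : Row) : forceRow f r = f r := by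
  induction r generalizing f with
  | nil => rfl
  | cons t r ih => exact ih fun s => f (t :: s)

theorem forceNat_eq {α : Type} (f : ℕ → α) (n : ℕ) : forceNat f n = f n := by
  cases n <;> rfl

theorem insertRow_spec {α : Type} (T : List Row) (hT : ∀ R ∈ T, Row.eval g R = 0) (r : Row)
    (hr : Row.eval g r = 0) (f : List Row → α) :
    ∃ T', (∀ R ∈ T', Row.eval g R = 0) ∧ insertRow T r f = f T' := by
  induction T generalizing r f with
  | nil =>
    rcases r with _ | ⟨x, r⟩
    · exact ⟨[], by simp, rfl⟩
    · exact ⟨[x :: r], by simpa using hr, forceRow_eq _ _⟩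
  | cons R T ih =>
    rw [List.forall_mem_cons] at hT
    rcases R with _ | ⟨t, s⟩
    · exact ih hT.2 r hr f
    rcases r with _ | ⟨t', r⟩
    · exact ⟨(t :: s) :: T, List.forall_mem_cons.2 hT, rfl⟩
    change ∃ T', _ ∧ (Bool.casesOn (Nat.ble t.1 t'.1)
      (insertRow T (t' :: r) fun T' => f ((t :: s) :: T'))
      (Bool.casesOn (Nat.ble t'.1 t.1) (forceRow (fun s' => f (s' :: (t :: s) :: T)) (t' :: r))
        (insertRow T (cancelLeading t t' (t' :: r) (t :: s)) fun T' => f ((t :: s) :: T'))) : α) = _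
    rcases Nat.ble t.1 t'.1
    · obtain ⟨T', h, h'⟩ := ih hT.2 _ hr fun T' => f ((t :: s) :: T')
      exact ⟨_, List.forall_mem_cons.2 ⟨hT.1, h⟩, h'⟩
    · rcases Nat.ble t'.1 t.1
      · exact ⟨_, List.forall_mem_cons.2 ⟨hr, List.forall_mem_cons.2 hT⟩, forceRow_eq _ _⟩
      · obtain ⟨T', h, h'⟩ := ih hT.2 _ (Row.eval_cancelLeading g hr hT.1)
          fun T' => f ((t :: s) :: T')
        exact ⟨_, List.forall_mem_cons.2 ⟨hT.1, h⟩, h'⟩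

theorem insertRows_spec {α β : Type} (row : β → Row) (f : List Row → α) (L : List β)
    (hL : ∀ d ∈ L, Row.eval g (row d) = 0) (T : List Row) (hT : ∀ R ∈ T, Row.eval g R = 0) :
    ∃ T', (∀ R ∈ T', Row.eval g R = 0) ∧ insertRows row f L T = f T' := by
  induction L generalizing T with
  | nil => exact ⟨T, hT, rfl⟩
  | cons d L ih =>
    rw [List.forall_mem_cons] at hL
    obtain ⟨T', h, h'⟩ := insertRow_spec g T hT _ hL.1 (insertRows row f L)
    obtain ⟨T'', h2, h2'⟩ := ih hL.2 T' h
    exact ⟨T'', h2, h'.trans h2'⟩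

theorem solvedMask_spec [Module ℚ M] {α : Type} (f : ℕ → α) (T : List Row)
    (hT : ∀ R ∈ T, Row.eval g R = 0) :
    ∃ m : ℕ, (∀ k, m.testBit k = true → g k = 0) ∧ solvedMask f T = f m := by
  induction T generalizing f with
  | nil => exact ⟨0, by simp, rfl⟩
  | cons R T ih =>
    rw [List.forall_mem_cons] at hT
    rcases R with _ | ⟨⟨k, x, y⟩, s⟩
    · exact ih f hT.2
    obtain ⟨m, hm, h⟩ := ih (fun m => bif s.all (fun t => m.testBit t.1) && !(Nat.beq x y) then
      forceNat f (m ||| 2 ^ k) else f m) hT.2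
    by_cases hc : (s.all (fun t => m.testBit t.1) && !(Nat.beq x y)) = true
    · refine ⟨m ||| 2 ^ k, fun l hl => ?_, ?_⟩
      · rw [Nat.testBit_or, Bool.or_eq_true, Nat.testBit_two_pow, decide_eq_true_iff] at hl
        rcases hl with hl | rfl
        · exact hm l hl
        rw [Bool.and_eq_true, List.all_eq_true, Bool.not_eq_true'] at hc
        have hs : Row.eval g s = 0 := List.sum_eq_zero fun v hv => by
          obtain ⟨t, ht, rfl⟩ := List.mem_map.1 hv
          rw [hm _ (hc.1 t ht), smul_zero]
        have h0 := hT.1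
        rw [Row.eval_cons, hs, add_zero] at h0
        have hxy : x ≠ y := fun e => by simp [e] at hc
        rw [← Int.cast_smul_eq_zsmul ℚ] at h0
        refine (smul_eq_zero.1 h0).resolve_left ?_
        change ((x - y : ℤ) : ℚ) ≠ 0
        rw [Int.cast_ne_zero, sub_ne_zero]
        exact_mod_cast hxy
      · rw [solvedMask, h]
        simp only [hc, cond_true, forceNat_eq]
    · refine ⟨m, hm, ?_⟩
      rw [solvedMask, h]
      rw [Bool.not_eq_true] at hc
      simp only [hc, cond_false]

theorem eq_zero_of_checkSpan [Module ℚ M] (f : List ℕ → M) {n : ℕ} {T : List (List (List ℕ))}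
    {R : List (List ℕ × List ℕ × List ℕ)} (h : checkSpan n T R = true)
    (hT : ∀ W ∈ T, ((stuffleProd W).map f).sum = 0)
    (hR : ∀ z u v, (((shuffleWords u v).flatMap (stuffle z)).map f).sum =
      (-1 : ℤ) ^ reflExponent u • ((stuffle z (u.reverse ++ v)).map f).sum)
    {w : List ℕ} (hw : w ∈ words n) : f w = 0 := by
  set g : ℕ → M := fun k => f (Function.invFun wordKey k) with hg
  have hgf : ∀ w, g (wordKey w) = f w := fun w => by
    rw [hg]
    exact congrArg f (Function.leftInverse_invFun wordKey_injective w)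
  obtain ⟨T₁, h₁, e₁⟩ := insertRows_spec g productRow (insertRows relationRow (solvedMask fun m =>
    (words n).all fun w => m.testBit (wordKey w)) R) T (fun W hW => by
      rw [productRow, Row.eval_addWords]
      simp only [hgf, hT W hW, smul_zero, Row.eval_nil, add_zero]) [] (by simp)
  obtain ⟨T₂, h₂, e₂⟩ := insertRows_spec g relationRow (solvedMask fun m =>
    (words n).all fun w => m.testBit (wordKey w)) R (fun d _ => by
      obtain ⟨z, u, v⟩ := d
      rw [relationRow, Row.eval_addWords, Row.eval_addWords]
      simp only [hgf, hR, List.reverseAux_eq, Row.eval_nil, add_zero]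
      rcases Nat.even_or_odd (reflExponent u) with he | he
      · rw [he.neg_one_pow, Nat.even_iff.1 he]; simp
      · rw [he.neg_one_pow, Nat.odd_iff.1 he]; simp) T₁ h₁
  obtain ⟨m, hm, e₃⟩ := solvedMask_spec g (fun m => (words n).all fun w => m.testBit (wordKey w))
    T₂ h₂
  rw [checkSpan, e₁, e₂, e₃, List.all_eq_true] at h
  rw [← hgf, hm _ (h w hw)]

end Soundness

section PartialSums

open PowerSeries Finset

/-- The summand `sgn(s) ^ n / n ^ |s|` of the index coded by `a`. -/
def letterTerm (K : Type) [Field K] (a n : ℕ) : K := ((-1) ^ a) ^ n / (n : K) ^ (a / 2 + 1)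

/-- `eulerPartialSum` for coded words. -/
def eulerSum (K : Type) [Field K] : List ℕ → ℕ → K
  | [], _ => 1
  | a :: t, N => ∑ n ∈ Ico 1 N, letterTerm K a n * eulerSum K t n

section Field

variable {K : Type} [Field K]

/-! ### The stuffle product -/

theorem neg_one_pow_mod_two (a : ℕ) : (-1 : K) ^ (a % 2) = (-1) ^ a := by
  conv_rhs => rw [← Nat.mod_add_div a 2, pow_add, pow_mul, neg_one_sq, one_pow, mul_one]

theorem letterTerm_mergeLetter (a b n : ℕ) :
    letterTerm K (mergeLetter a b) n = letterTerm K a n * letterTerm K b n := by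
  have h : mergeLetter a b / 2 + 1 = (a / 2 + 1) + (b / 2 + 1) := by
    unfold mergeLetter; omega
  have h' : (-1 : K) ^ mergeLetter a b = (-1) ^ a * (-1) ^ b := by
    rw [mergeLetter, pow_add, pow_mul, neg_one_sq, one_pow, one_mul, neg_one_pow_mod_two, pow_add]
  rw [letterTerm, letterTerm, letterTerm, h, h', pow_add, mul_pow, div_mul_div_comm]

theorem sum_map_eulerSum_cons (a N : ℕ) (W : List (List ℕ)) :
    (W.map fun w => eulerSum K (a :: w) N).sum =
      ∑ n ∈ Ico 1 N, letterTerm K a n * (W.map fun w => eulerSum K w n).sum := by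
  induction W with
  | nil => simp
  | cons w W ih =>
    simp only [List.map_cons, List.sum_cons, ih, mul_add, sum_add_distrib]
    rfl

theorem sum_Ico_mul_sum_Ico (F G : ℕ → K) (N : ℕ) :
    (∑ n ∈ Ico 1 N, F n) * ∑ n ∈ Ico 1 N, G n =
      ∑ n ∈ Ico 1 N, F n * ∑ m ∈ Ico 1 n, G m +
        (∑ n ∈ Ico 1 N, G n * ∑ m ∈ Ico 1 n, F m + ∑ n ∈ Ico 1 N, F n * G n) := by
  induction N with
  | zero => simp
  | succ N ih =>
    rcases Nat.eq_zero_or_pos N with rfl | hN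
    · simp
    · simp only [sum_Ico_succ_top hN]
      linear_combination ih

theorem sum_stuffle (u v : List ℕ) (N : ℕ) :
    ((stuffle u v).map fun w => eulerSum K w N).sum = eulerSum K u N * eulerSum K v N := by
  induction u generalizing v N with
  | nil => simp [stuffle, eulerSum]
  | cons a u ih =>
    induction v generalizing N with
    | nil => simp [stuffle, stuffleAux, eulerSum]
    | cons b v ihv =>
      have e : stuffle (a :: u) (b :: v) = (stuffle u (b :: v)).map (a :: ·) ++
        ((stuffle (a :: u) v).map (b :: ·) ++ (stuffle u v).map (mergeLetter a b :: ·)) := rfl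
      rw [e]
      simp only [List.map_append, List.map_map, List.sum_append, Function.comp_def,
        sum_map_eulerSum_cons, ih, ihv, letterTerm_mergeLetter]
      rw [show eulerSum K (a :: u) N = ∑ n ∈ Ico 1 N, letterTerm K a n * eulerSum K u n from rfl,
        show eulerSum K (b :: v) N = ∑ n ∈ Ico 1 N, letterTerm K b n * eulerSum K v n from rfl,
        sum_Ico_mul_sum_Ico]
      congr 1
      · exact sum_congr rfl fun n _ => by simp only [eulerSum]; ring
      congr 1
      · exact sum_congr rfl fun n _ => by simp only [eulerSum]; ring
      · exact sum_congr rfl fun n _ => by ring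

/-! ### The shuffle product of iterated integrals -/

/-- The differential form, divided by `dt / t`, of a letter. -/
noncomputable def formSeries (K : Type) [Field K] (x : ℕ) : K⟦X⟧ :=
  if x = 0 then 1 else mk fun n => if n = 0 then 0 else ((-1) ^ x) ^ n

/-- The expansion of an iterated integral (with the convention `1 / n = 0` for `n = 0` in `K`). -/
noncomputable def iterSeries (K : Type) [Field K] : List ℕ → K⟦X⟧
  | [] => 1
  | x :: l => mk fun m => coeff m (formSeries K x * iterSeries K l) / m

/-- The operator `t d/dt`. -/
noncomputable def theta : K⟦X⟧ →ₗ[K] K⟦X⟧ where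
  toFun f := mk fun m => m * coeff m f
  map_add' f g := by ext; simp [mul_add]
  map_smul' c f := by ext; simp [mul_left_comm]

@[simp] theorem coeff_theta (m : ℕ) (f : K⟦X⟧) : coeff m (theta f) = m * coeff m f := by
  simp [theta]

theorem theta_mul (f g : K⟦X⟧) : theta (f * g) = theta f * g + f * theta g := by
  ext m
  simp only [coeff_theta, map_add, coeff_mul, ← sum_add_distrib, mul_sum]
  refine sum_congr rfl fun x hx => ?_
  rw [← mem_antidiagonal.1 hx]
  push_cast
  ring

/-- Convergent iterated integrals. -/
def Admissible (l : List ℕ) : Prop := l.getLast? ≠ some 0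

theorem Admissible.tail {x : ℕ} {l : List ℕ} (h : Admissible (x :: l)) : Admissible l := by
  cases l with
  | nil => simp [Admissible]
  | cons y l => simpa [Admissible, List.getLast?_cons_cons] using h

theorem Admissible.ne_nil {l : List ℕ} (h : Admissible (0 :: l)) : l ≠ [] := by
  rintro rfl
  exact h rfl

theorem Admissible.cons (x : ℕ) {l : List ℕ} (h : Admissible l) (hl : l ≠ []) :
    Admissible (x :: l) := by
  cases l with
  | nil => exact absurd rfl hl
  | cons y l => simpa [Admissible, List.getLast?_cons_cons] using h

theorem Admissible.shuffle {u v w : List ℕ} (hu : Admissible u) (hv : Admissible v)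
    (hw : w ∈ shuffle u v) : Admissible w ∧ (w = [] → u = [] ∧ v = []) := by
  induction u generalizing v w with
  | nil =>
    rw [FiniteEuler.shuffle, List.mem_singleton] at hw
    subst hw
    exact ⟨hv, fun h => ⟨rfl, h⟩⟩
  | cons a u ih =>
    induction v generalizing w with
    | nil =>
      rw [FiniteEuler.shuffle, shuffleAux, List.mem_singleton] at hw
      subst hw
      exact ⟨hu, fun h => ⟨h, rfl⟩⟩
    | cons b v ihv =>
      have hw' : w ∈ (FiniteEuler.shuffle u (b :: v)).map (a :: ·) ++
        (FiniteEuler.shuffle (a :: u) v).map (b :: ·) := hw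
      rw [List.mem_append, List.mem_map, List.mem_map] at hw'
      rcases hw' with ⟨w, h, rfl⟩ | ⟨w, h, rfl⟩
      · obtain ⟨h1, h2⟩ := ih hu.tail hv h
        exact ⟨h1.cons a fun e => by simpa using (h2 e).2, by simp⟩
      · obtain ⟨h1, h2⟩ := ihv hv.tail h
        exact ⟨h1.cons b fun e => by simpa using (h2 e).1, by simp⟩

theorem coeff_zero_iterSeries_cons (x : ℕ) (l : List ℕ) : coeff 0 (iterSeries K (x :: l)) = 0 := by
  simp [iterSeries]

variable {p : ℕ}

theorem theta_iterSeries (hp : ∀ m : ℕ, 0 < m → m < p → (m : K) ≠ 0) {x : ℕ} {l : List ℕ}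
    (h : Admissible (x :: l)) :
    X ^ p ∣ theta (iterSeries K (x :: l)) - formSeries K x * iterSeries K l := by
  rw [X_pow_dvd_iff]
  intro m hm
  rw [map_sub, coeff_theta, iterSeries, coeff_mk]
  rcases Nat.eq_zero_or_pos m with rfl | h0
  · rcases Nat.eq_zero_or_pos x with rfl | hx
    · obtain ⟨y, t, rfl⟩ := List.exists_cons_of_ne_nil h.ne_nil
      simp [formSeries, iterSeries]
    · simp [formSeries, hx.ne']
  · rw [mul_div_cancel₀ _ (hp m h0 hm), sub_self]

theorem sum_theta_iterSeries (hp : ∀ m : ℕ, 0 < m → m < p → (m : K) ≠ 0) (x : ℕ)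
    (W : List (List ℕ)) (h : ∀ w ∈ W, Admissible (x :: w)) :
    X ^ p ∣ theta (W.map fun w => iterSeries K (x :: w)).sum -
      formSeries K x * (W.map (iterSeries K)).sum := by
  induction W with
  | nil => simp
  | cons w W ih =>
    rw [List.forall_mem_cons] at h
    simp only [List.map_cons, List.sum_cons, map_add, mul_add]
    rw [add_sub_add_comm]
    exact dvd_add (theta_iterSeries hp h.1) (ih h.2)

theorem coeff_zero_sum_iterSeries_cons (x : ℕ) (W : List (List ℕ)) :
    coeff 0 (W.map fun w => iterSeries K (x :: w)).sum = 0 := by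
  induction W with
  | nil => simp
  | cons w W ih =>
    rw [List.map_cons, List.sum_cons, map_add, ih, coeff_zero_iterSeries_cons, add_zero]

theorem X_pow_dvd_of_theta (hp : ∀ m : ℕ, 0 < m → m < p → (m : K) ≠ 0) {f : K⟦X⟧}
    (h : X ^ p ∣ theta f) (h0 : coeff 0 f = 0) : X ^ p ∣ f := by
  rw [X_pow_dvd_iff] at h ⊢
  intro m hm
  rcases Nat.eq_zero_or_pos m with rfl | hm0
  · exact h0
  · have := h m hm
    rw [coeff_theta] at this
    exact (mul_eq_zero.1 this).resolve_left (hp m hm0 hm)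

theorem iterSeries_mul (hp : ∀ m : ℕ, 0 < m → m < p → (m : K) ≠ 0) {u v : List ℕ}
    (hu : Admissible u) (hv : Admissible v) :
    X ^ p ∣ iterSeries K u * iterSeries K v - ((shuffle u v).map (iterSeries K)).sum := by
  induction u generalizing v with
  | nil => simp [shuffle, iterSeries]
  | cons a u ih =>
    induction v with
    | nil => simp [shuffle, shuffleAux, iterSeries]
    | cons b v ihv =>
      have e : shuffle (a :: u) (b :: v) = (shuffle u (b :: v)).map (a :: ·) ++
        (shuffle (a :: u) v).map (b :: ·) := rfl
      have hadm : ∀ w ∈ shuffle (a :: u) (b :: v), Admissible w := fun w hw =>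
        (hu.shuffle hv hw).1
      rw [e] at hadm ⊢
      simp only [List.mem_append, List.mem_map, or_imp, forall_and, forall_exists_index, and_imp,
        forall_apply_eq_imp_iff₂] at hadm
      simp only [List.map_append, List.map_map, List.sum_append, Function.comp_def]
      refine X_pow_dvd_of_theta hp ?_ ?_
      · rw [map_sub, map_add, theta_mul]
        have h1 := (theta_iterSeries hp hu).mul_right (iterSeries K (b :: v))
        have h2 := (theta_iterSeries hp hv).mul_left (iterSeries K (a :: u))
        have h3 := sum_theta_iterSeries hp a _ hadm.1
        have h4 := sum_theta_iterSeries hp b _ hadm.2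
        have h5 := (ih hu.tail hv).mul_left (formSeries K a)
        have h6 := (ihv hv.tail).mul_left (formSeries K b)
        convert dvd_add (dvd_add (dvd_sub (dvd_add h1 h2) (dvd_add h3 h4)) h5) h6 using 1
        ring
      · rw [map_sub, map_add, coeff_zero_sum_iterSeries_cons, coeff_zero_sum_iterSeries_cons,
          coeff_zero_eq_constantCoeff, map_mul, ← coeff_zero_eq_constantCoeff_apply,
          coeff_zero_iterSeries_cons]
        simp

/-! ### Euler sums as coefficients of iterated integrals -/

/-- The part of the sum of a word whose largest variable is `m`. -/
def topTerm (K : Type) [Field K] : List ℕ → ℕ → K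
  | [], m => if m = 0 then 1 else 0
  | a :: t, m => letterTerm K a m * eulerSum K t m

theorem letterTerm_zero (a : ℕ) : letterTerm K a 0 = 0 := by simp [letterTerm]

theorem sum_topTerm (w : List ℕ) {N : ℕ} (hN : 0 < N) :
    ∑ m ∈ range N, topTerm K w m = eulerSum K w N := by
  cases w with
  | nil => simp [topTerm, eulerSum, hN.ne']
  | cons a t =>
    rw [range_eq_Ico, sum_eq_sum_Ico_succ_bot hN]
    simp [topTerm, eulerSum, letterTerm_zero]

theorem coeff_formSeries_succ_mul (x m : ℕ) (f : K⟦X⟧) :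
    coeff m (formSeries K (x + 1) * f) =
      ∑ k ∈ range m, ((-1) ^ (x + 1)) ^ (m - k) * coeff k f := by
  rw [mul_comm, coeff_mul, Nat.sum_antidiagonal_eq_sum_range_succ_mk, sum_range_succ]
  simp only [formSeries, Nat.add_eq_zero_iff, one_ne_zero, and_false, if_false, coeff_mk,
    Nat.sub_self, if_true, mul_zero, add_zero]
  refine sum_congr rfl fun k hk => ?_
  rw [if_neg (by have := mem_range.1 hk; omega), mul_comm]

theorem coeff_iterSeries {l : List ℕ} (hl : Admissible l) (b s m : ℕ) (h : l ≠ [] ∨ s = 0) :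
    coeff m (iterSeries K l) / (m : K) ^ s = ((-1) ^ b) ^ m * topTerm K (ofLetters b s l) m := by
  induction l generalizing b s m with
  | nil =>
    obtain rfl := h.resolve_left (by simp)
    by_cases hm : m = 0 <;> simp [iterSeries, ofLetters, topTerm, coeff_one, hm]
  | cons x l ih =>
    rcases x with _ | x
    · rw [ofLetters, ← ih hl.tail b (s + 1) m (Or.inl hl.ne_nil), iterSeries, coeff_mk, formSeries,
        if_pos rfl, one_mul, div_div, pow_succ']
    · rw [ofLetters, topTerm, iterSeries, coeff_mk, div_div, ← pow_succ', coeff_formSeries_succ_mul]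
      rcases Nat.eq_zero_or_pos m with rfl | hm
      · simp [letterTerm_zero]
      have h1 : ∀ k ∈ range m, ((-1 : K) ^ (x + 1)) ^ (m - k) * coeff k (iterSeries K l) =
          ((-1) ^ (x + 1)) ^ m * topTerm K (ofLetters (x + 1) 0 l) k := fun k hk => by
        have := ih hl.tail (x + 1) 0 k (Or.inr rfl)
        rw [pow_zero, div_one] at this
        rw [this, ← mul_assoc, ← pow_add, Nat.sub_add_cancel (mem_range.1 hk).le]
      have h2 : ((-1 : K) ^ b) ^ m * ((-1) ^ (2 * s + (x + 1 + b) % 2)) ^ m =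
          ((-1) ^ (x + 1)) ^ m := by
        rw [← mul_pow, pow_add _ (2 * s), pow_mul _ 2, neg_one_sq, one_pow, one_mul,
          neg_one_pow_mod_two, ← pow_add, show b + (x + 1 + b) = x + 1 + 2 * b by ring,
          pow_add _ (x + 1), pow_mul _ 2, neg_one_sq, one_pow, mul_one]
      rw [sum_congr rfl h1, ← mul_sum, sum_topTerm _ hm, letterTerm,
        show (2 * s + (x + 1 + b) % 2) / 2 + 1 = s + 1 by omega, ← h2]
      ring

theorem ofLetters_replicate (b s k y : ℕ) (l : List ℕ) :
    ofLetters b s (List.replicate k 0 ++ (y + 1) :: l) =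
      (2 * (s + k) + (y + 1 + b) % 2) :: ofLetters (y + 1) 0 l := by
  induction k generalizing s with
  | zero => rfl
  | succ k ih =>
    rw [List.replicate_succ, List.cons_append, ofLetters, ih]
    congr 3
    ring

theorem ofLetters_toLetters {b b' : ℕ} (h : b % 2 = b' % 2) (w : List ℕ) :
    ofLetters b 0 (toLetters b' w) = w := by
  induction w generalizing b b' with
  | nil => rfl
  | cons a t ih =>
    rw [toLetters, ofLetters_replicate, ih (by omega)]
    congr 1
    omega

theorem admissible_toLetters (b : ℕ) (w : List ℕ) : Admissible (toLetters b w) := by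
  induction w generalizing b with
  | nil => simp [Admissible, toLetters]
  | cons a t ih =>
    have h : Admissible (((b + a) % 2 + 2) :: toLetters (b + a) t) := by
      rcases ht : toLetters (b + a) t with _ | ⟨y, l⟩
      · simp [Admissible]
      · exact Admissible.cons _ (ht ▸ ih _) (by simp)
    rw [toLetters]
    induction a / 2 with
    | zero => exact h
    | succ k ihk => exact Admissible.cons 0 ihk (by simp)

theorem coeff_iterSeries_toLetters (w : List ℕ) (m : ℕ) :
    coeff m (iterSeries K (toLetters 0 w)) = topTerm K w m := by
  have := coeff_iterSeries (K := K) (admissible_toLetters 0 w) 0 0 m (Or.inr rfl)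
  rwa [ofLetters_toLetters rfl, pow_zero, pow_zero, div_one, one_pow, one_mul] at this

/-! ### The shuffle relation -/

/-- The sum over `m + n < p` of the products of the summands of two words. -/
def truncatedProduct (K : Type) [Field K] (p : ℕ) (u v : List ℕ) : K :=
  ∑ m ∈ range p, topTerm K u m * eulerSum K v (p - m)

theorem truncatedProduct_eq_sum_coeff (u v : List ℕ) :
    truncatedProduct K p u v = ∑ m ∈ range p, coeff m (mk (topTerm K u) * mk (topTerm K v)) := by
  simp only [coeff_mul, Nat.sum_antidiagonal_eq_sum_range_succ_mk, coeff_mk]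
  rw [sum_range_diag_flip p fun i j => topTerm K u i * topTerm K v j]
  refine sum_congr rfl fun m hm => ?_
  rw [← mul_sum, sum_topTerm _ (Nat.sub_pos_of_lt (mem_range.1 hm))]

theorem truncatedProduct_comm (u v : List ℕ) :
    truncatedProduct K p u v = truncatedProduct K p v u := by
  simp only [truncatedProduct_eq_sum_coeff, mul_comm]

theorem letterTerm_sub (hp0 : (p : K) = 0) (hodd : Odd p) (a : ℕ) {n : ℕ} (hn : n ≤ p) :
    letterTerm K a (p - n) = (-1) ^ (a / 2 + 1 + a) * letterTerm K a n := by
  have h : ((-1 : K) ^ a) ^ (p - n) = (-1) ^ a * ((-1) ^ a) ^ n := by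
    have h1 : ((-1 : K) ^ a) ^ n * ((-1) ^ a) ^ n = 1 := by
      rw [← mul_pow, ← pow_add, ← two_mul, pow_mul, neg_one_sq, one_pow, one_pow]
    have h2 : ((-1 : K) ^ a) ^ (p - n) * ((-1) ^ a) ^ n = (-1) ^ a := by
      rw [← pow_add, Nat.sub_add_cancel hn, ← pow_mul, mul_comm, pow_mul, hodd.neg_one_pow]
    calc _ = ((-1 : K) ^ a) ^ (p - n) * (((-1) ^ a) ^ n * ((-1) ^ a) ^ n) := by rw [h1, mul_one]
      _ = _ := by rw [← mul_assoc, h2]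
  have h3 : ((-1 : K) ^ (a / 2 + 1))⁻¹ = (-1) ^ (a / 2 + 1) := by
    rw [← inv_pow, inv_neg_one]
  rw [letterTerm, letterTerm, h, Nat.cast_sub hn, hp0, zero_sub, neg_pow (n : K), div_eq_mul_inv,
    mul_inv, h3, pow_add]
  ring

theorem truncatedProduct_cons (hp : 0 < p) (hp0 : (p : K) = 0) (hodd : Odd p) (a : ℕ)
    (u v : List ℕ) :
    truncatedProduct K p (a :: u) v =
      (-1) ^ (a / 2 + 1 + a) * truncatedProduct K p u (a :: v) := by
  rw [truncatedProduct_comm u]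
  simp only [truncatedProduct, range_eq_Ico, sum_eq_sum_Ico_succ_bot hp, topTerm, letterTerm_zero,
    zero_mul, zero_add, mul_sum]
  refine sum_nbij' (p - ·) (p - ·) ?_ ?_ ?_ ?_ ?_
  · intro n hn; rw [mem_Ico] at hn ⊢; omega
  · intro n hn; rw [mem_Ico] at hn ⊢; omega
  · intro n hn; rw [mem_Ico] at hn; omega
  · intro n hn; rw [mem_Ico] at hn; omega
  · intro n hn
    rw [mem_Ico] at hn
    have h : p - (p - n) = n := by omega
    have h1 : (-1 : K) ^ (a / 2 + 1 + a) * (-1) ^ (a / 2 + 1 + a) = 1 := by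
      rw [← pow_add, ← two_mul, pow_mul, neg_one_sq, one_pow]
    rw [letterTerm_sub hp0 hodd a hn.2.le, h]
    linear_combination -(letterTerm K a n * eulerSum K u n * eulerSum K v (p - n)) * h1

theorem truncatedProduct_eq (hp : 0 < p) (hp0 : (p : K) = 0) (hodd : Odd p) (u v : List ℕ) :
    truncatedProduct K p u v = (-1) ^ reflExponent u * eulerSum K (u.reverse ++ v) p := by
  induction u generalizing v with
  | nil =>
    simp only [truncatedProduct, range_eq_Ico, sum_eq_sum_Ico_succ_bot hp]
    rw [sum_eq_zero fun n hn => by rw [topTerm, if_neg (by rw [mem_Ico] at hn; omega), zero_mul]]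
    simp [topTerm, reflExponent]
  | cons a u ih =>
    rw [truncatedProduct_cons hp hp0 hodd, ih, ← mul_assoc, ← pow_add]
    simp [reflExponent]

theorem sum_shuffleWords (hp : ∀ m : ℕ, 0 < m → m < p → (m : K) ≠ 0) (hp0 : (p : K) = 0)
    (hodd : Odd p) (u v : List ℕ) :
    ((shuffleWords u v).map fun w => eulerSum K w p).sum =
      (-1) ^ reflExponent u * eulerSum K (u.reverse ++ v) p := by
  have hp1 : 0 < p := hodd.pos
  have hu := admissible_toLetters 0 u
  have hv := admissible_toLetters 0 v
  have key : ∀ W : List (List ℕ), (∀ l ∈ W, Admissible l) →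
      (W.map fun l => eulerSum K (ofLetters 0 0 l) p).sum =
        ∑ m ∈ range p, coeff m (W.map (iterSeries K)).sum := by
    intro W hW
    induction W with
    | nil => simp
    | cons l W ih =>
      rw [List.forall_mem_cons] at hW
      simp only [List.map_cons, List.sum_cons, map_add, sum_add_distrib, ih hW.2]
      rw [← sum_topTerm _ hp1]
      congr 1
      refine sum_congr rfl fun m _ => ?_
      simpa using (coeff_iterSeries (K := K) hW.1 0 0 m (Or.inr rfl)).symm
  rw [shuffleWords, List.map_map, Function.comp_def, key _ fun l hl => (hu.shuffle hv hl).1,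
    ← truncatedProduct_eq hp1 hp0 hodd, truncatedProduct_eq_sum_coeff]
  refine sum_congr rfl fun m hm => ?_
  have h := X_pow_dvd_iff.1 (iterSeries_mul hp hu hv) m (mem_range.1 hm)
  rw [map_sub, sub_eq_zero] at h
  rw [← h]
  congr 2 <;> ext n <;> rw [coeff_iterSeries_toLetters, coeff_mk]

end Field

end PartialSums

/-! ### Reduction of rational numbers modulo `p` -/

section Residues

open Finset

variable {p : ℕ} [Fact p.Prime]

/-- `x` is `p`-integral and has residue `y`. -/
def HasResidue (x : ℚ) (y : ZMod p) : Prop := (x.den : ZMod p) ≠ 0 ∧ (x : ZMod p) = y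

theorem HasResidue.of_den_dvd {x : ℚ} {n : ℕ} (h : x.den ∣ n) (hn : (n : ZMod p) ≠ 0) :
    (x.den : ZMod p) ≠ 0 := by
  obtain ⟨m, rfl⟩ := h
  rw [Nat.cast_mul] at hn
  exact left_ne_zero_of_mul hn

theorem HasResidue.add {x x' : ℚ} {y y' : ZMod p} (h : HasResidue x y) (h' : HasResidue x' y') :
    HasResidue (x + x') (y + y') := by
  refine ⟨HasResidue.of_den_dvd (Rat.add_den_dvd x x') ?_, ?_⟩
  · rw [Nat.cast_mul]; exact mul_ne_zero h.1 h'.1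
  · rw [Rat.cast_add_of_ne_zero h.1 h'.1, h.2, h'.2]

theorem HasResidue.mul {x x' : ℚ} {y y' : ZMod p} (h : HasResidue x y) (h' : HasResidue x' y') :
    HasResidue (x * x') (y * y') := by
  refine ⟨HasResidue.of_den_dvd (Rat.mul_den_dvd x x') ?_, ?_⟩
  · rw [Nat.cast_mul]; exact mul_ne_zero h.1 h'.1
  · rw [Rat.cast_mul_of_ne_zero h.1 h'.1, h.2, h'.2]

theorem HasResidue.intCast (n : ℤ) : HasResidue (p := p) n n := by simp [HasResidue]

theorem HasResidue.natCast (n : ℕ) : HasResidue (p := p) n n := by simp [HasResidue]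

theorem HasResidue.inv_natCast {n : ℕ} (h : (n : ZMod p) ≠ 0) :
    HasResidue (p := p) (n : ℚ)⁻¹ (n : ZMod p)⁻¹ := by
  refine ⟨?_, by simp⟩
  rcases Nat.eq_zero_or_pos n with rfl | hn
  · simp at h
  · rwa [Rat.inv_natCast_den_of_pos hn]

theorem HasResidue.sum {ι : Type} (s : Finset ι) {x : ι → ℚ} {y : ι → ZMod p}
    (h : ∀ i ∈ s, HasResidue (x i) (y i)) : HasResidue (∑ i ∈ s, x i) (∑ i ∈ s, y i) := by
  classical
  induction s using Finset.induction_on with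
  | empty => simpa using HasResidue.natCast (p := p) 0
  | insert a s ha ih =>
    rw [sum_insert ha, sum_insert ha]
    exact (h a (mem_insert_self _ _)).add (ih fun i hi => h i (mem_insert_of_mem hi))

theorem natCast_ne_zero_of_lt {m : ℕ} (h0 : 0 < m) (h : m < p) : (m : ZMod p) ≠ 0 := by
  rw [Ne, ZMod.natCast_eq_zero_iff]
  exact Nat.not_dvd_of_pos_of_lt h0 h

theorem bernoulli'_hasResidue {n : ℕ} (hn : n + 1 < p) :
    HasResidue (p := p) (bernoulli' n) (bernoulli' n) := by
  induction n using Nat.strong_induction_on with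
  | _ n ih =>
    refine ⟨?_, rfl⟩
    rw [bernoulli'_def, sub_eq_add_neg, ← neg_one_mul]
    have h : ∀ k ∈ range n, HasResidue (p := p) ((n.choose k : ℚ) / (n - k + 1) * bernoulli' k)
        (n.choose k * ((n - k + 1 : ℕ) : ZMod p)⁻¹ * bernoulli' k) := fun k hk => by
      have hk := mem_range.1 hk
      have e : (n - k + 1 : ℚ) = ((n - k + 1 : ℕ) : ℚ) := by push_cast [hk.le]; ring
      rw [e, div_eq_mul_inv]
      exact ((HasResidue.natCast _).mul (.inv_natCast
        (natCast_ne_zero_of_lt (by omega) (by omega)))).mul (ih k hk (by omega))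
    have := (HasResidue.natCast (p := p) 1).add
      ((HasResidue.intCast (p := p) (-1)).mul (HasResidue.sum _ h))
    have := this.1
    push_cast at this
    exact this

theorem bernoulli_hasResidue {n : ℕ} (hn : n + 1 < p) :
    HasResidue (p := p) (bernoulli n) (bernoulli n) := by
  have := (HasResidue.intCast (p := p) ((-1) ^ n)).mul (bernoulli'_hasResidue hn)
  refine ⟨?_, rfl⟩
  have h := this.1
  push_cast at h
  exact h

theorem sum_range_pow_residue {k : ℕ} (hk : k + 1 < p) (n : ℕ) :
    ∑ m ∈ range n, (m : ZMod p) ^ k = ∑ i ∈ range (k + 1),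
      (bernoulli i : ZMod p) * (k + 1).choose i * (n : ZMod p) ^ (k + 1 - i) *
        ((k + 1 : ℕ) : ZMod p)⁻¹ := by
  have h1 : HasResidue (p := p) (∑ m ∈ range n, (m : ℚ) ^ k) (∑ m ∈ range n, (m : ZMod p) ^ k) :=
    HasResidue.sum _ fun m _ => by simpa using HasResidue.natCast (p := p) (m ^ k)
  have h2 : HasResidue (p := p) (∑ m ∈ range n, (m : ℚ) ^ k) (∑ i ∈ range (k + 1),
      (bernoulli i : ZMod p) * (k + 1).choose i * (n : ZMod p) ^ (k + 1 - i) *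
        ((k + 1 : ℕ) : ZMod p)⁻¹) := by
    rw [sum_range_pow]
    refine HasResidue.sum _ fun i hi => ?_
    have hi := mem_range.1 hi
    rw [div_eq_mul_inv]
    have := (((bernoulli_hasResidue (p := p) (n := i) (by omega)).mul
      (.natCast ((k + 1).choose i))).mul (.natCast (n ^ (k + 1 - i)))).mul
      (.inv_natCast (natCast_ne_zero_of_lt (m := k + 1) (by omega) hk))
    push_cast at this ⊢
    exact this
  rw [← h1.2, h2.2]

theorem sum_Ico_pow_residue {j : ℕ} (hj : j < p - 1) :
    ∑ n ∈ Ico 1 p, (n : ZMod p) ^ j = if j = 0 then -1 else 0 := by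
  have hp : 0 < p := (Fact.out : p.Prime).pos
  have h : ∑ n ∈ range p, (n : ZMod p) ^ j = 0 := by
    rw [← FiniteField.sum_pow_lt_card_sub_one (K := ZMod p) j (by rwa [ZMod.card])]
    refine sum_nbij' (fun n => (n : ZMod p)) ZMod.val ?_ ?_ ?_ ?_ ?_
    · simp
    · intro x _; rw [mem_range]; exact ZMod.val_lt x
    · intro n hn; exact ZMod.val_cast_of_lt (mem_range.1 hn)
    · intro x _; simp
    · simp
  rw [range_eq_Ico, sum_eq_sum_Ico_succ_bot hp] at h
  rcases Nat.eq_zero_or_pos j with rfl | hj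
  · simp only [pow_zero] at h ⊢
    simp only [if_true]
    linear_combination h
  · rw [if_neg hj.ne']
    simpa [hj.ne'] using h

theorem eulerSum_one_sub_one {w : ℕ} (hw : 2 ≤ w) (hp : w < p) :
    eulerSum (ZMod p) [0, 2 * (w - 2)] p = -(bernoulli (p - w) : ZMod p) := by
  obtain ⟨k, hk⟩ : ∃ k, k = p - w := ⟨_, rfl⟩
  have hinner : ∀ n ∈ Ico 1 p, eulerSum (ZMod p) [2 * (w - 2)] n =
      ∑ m ∈ range n, (m : ZMod p) ^ k := fun n hn => by
    rw [mem_Ico] at hn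
    rw [range_eq_Ico, sum_eq_sum_Ico_succ_bot (by omega), Nat.cast_zero, zero_pow (by omega),
      zero_add, eulerSum]
    refine sum_congr rfl fun m hm => ?_
    rw [mem_Ico] at hm
    have hm0 : (m : ZMod p) ≠ 0 := natCast_ne_zero_of_lt (by omega) (by omega)
    rw [letterTerm, eulerSum, mul_one, pow_mul, neg_one_sq, one_pow, one_pow, div_eq_iff
      (pow_ne_zero _ hm0), ← pow_add, show k + (2 * (w - 2) / 2 + 1) = p - 1 by omega,
      ZMod.pow_card_sub_one_eq_one hm0]
  rw [← hk, eulerSum]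
  have hterm : ∀ n ∈ Ico 1 p, letterTerm (ZMod p) 0 n * eulerSum (ZMod p) [2 * (w - 2)] n =
      ∑ i ∈ range (k + 1), (bernoulli i : ZMod p) * (k + 1).choose i *
        ((k + 1 : ℕ) : ZMod p)⁻¹ * (n : ZMod p) ^ (k - i) := fun n hn => by
    rw [hinner n hn, sum_range_pow_residue (by omega), mul_sum]
    rw [mem_Ico] at hn
    have hn0 : (n : ZMod p) ≠ 0 := natCast_ne_zero_of_lt (by omega) (by omega)
    refine sum_congr rfl fun i hi => ?_
    rw [mem_range] at hi
    rw [show k + 1 - i = k - i + 1 by omega, pow_succ, letterTerm]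
    simp only [pow_zero, one_pow, Nat.zero_div, zero_add, pow_one]
    field_simp
  rw [sum_congr rfl hterm, sum_comm]
  simp only [← mul_sum]
  rw [sum_range_succ, sum_eq_zero, zero_add, sum_Ico_pow_residue (by omega), if_pos (by omega)]
  · rw [Nat.choose_succ_self_right]
    have : ((k + 1 : ℕ) : ZMod p) ≠ 0 := natCast_ne_zero_of_lt (by omega) (by omega)
    field_simp
  · intro i hi
    rw [mem_range] at hi
    rw [sum_Ico_pow_residue (by omega), if_neg (by omega), mul_zero]

theorem choose_sub_one_residue {k : ℕ} (hk : k < p) :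
    ((p - 1).choose k : ZMod p) = (-1) ^ k := by
  induction k with
  | zero => simp
  | succ k ih =>
    have hp : p - 1 + 1 = p := Nat.sub_add_cancel (Fact.out : p.Prime).pos
    have h : ((p.choose (k + 1) : ℕ) : ZMod p) = 0 := by
      rw [ZMod.natCast_eq_zero_iff]
      exact (Fact.out : p.Prime).dvd_choose_self (by omega) hk
    rw [show p.choose (k + 1) = (p - 1).choose k + (p - 1).choose (k + 1) by
      rw [← Nat.choose_succ_succ, Nat.succ_eq_add_one, hp], Nat.cast_add, ih (by omega)] at h
    rw [pow_succ]
    linear_combination h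

theorem eulerSum_bar_one (hp : 3 ≤ p) :
    eulerSum (ZMod p) [1] p = -2 * (((2 ^ (p - 1) - 1) / p : ℕ) : ZMod p) := by
  have hprime : p.Prime := Fact.out
  have hsucc : p - 1 + 1 = p := Nat.sub_add_cancel hprime.pos
  have hdvd : p ∣ 2 ^ (p - 1) - 1 := by
    rw [← ZMod.natCast_eq_zero_iff, Nat.cast_sub Nat.one_le_two_pow]
    push_cast
    have h2 : (2 : ZMod p) ≠ 0 := by
      exact_mod_cast natCast_ne_zero_of_lt (p := p) (m := 2) (by omega) (by omega)
    rw [ZMod.pow_card_sub_one_eq_one h2, sub_self]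
  obtain ⟨Q, hQ⟩ := hdvd
  rw [hQ, Nat.mul_div_cancel_left _ hprime.pos]
  have hc : ∀ k ∈ Ico 1 p, p * (p.choose k / p) = p.choose k := fun k hk => by
    rw [mem_Ico] at hk
    exact Nat.mul_div_cancel' (hprime.dvd_choose_self (by omega) hk.2)
  have hsum : 2 * Q = ∑ k ∈ Ico 1 p, p.choose k / p := by
    refine Nat.eq_of_mul_eq_mul_left hprime.pos ?_
    have h := Nat.sum_range_choose p
    rw [sum_range_succ, range_eq_Ico, sum_eq_sum_Ico_succ_bot hprime.pos, Nat.choose_zero_right,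
      Nat.choose_self] at h
    rw [mul_sum, sum_congr rfl hc]
    have h2 : 2 ^ p = 2 * 2 ^ (p - 1) := by rw [← pow_succ', hsucc]
    have h3 : 1 ≤ 2 ^ (p - 1) := Nat.one_le_two_pow
    rw [mul_left_comm, ← hQ]
    rw [h2] at h
    simp only [zero_add] at h
    replace h : 1 + (Ico 1 p).sum p.choose + 1 = 2 * 2 ^ (p - 1) := h
    omega
  have hsum' : (2 : ZMod p) * Q = ∑ k ∈ Ico 1 p, ((p.choose k / p : ℕ) : ZMod p) := by
    exact_mod_cast congrArg (Nat.cast : ℕ → ZMod p) hsum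
  rw [neg_mul, hsum', eulerSum, ← sum_neg_distrib]
  refine sum_congr rfl fun k hk => ?_
  have hk' := mem_Ico.1 hk
  have hk0 : (k : ZMod p) ≠ 0 := natCast_ne_zero_of_lt (by omega) hk'.2
  obtain ⟨j, rfl⟩ : ∃ j, k = j + 1 := ⟨k - 1, by omega⟩
  have h1 : (j + 1) * (p.choose (j + 1) / p) = (p - 1).choose j := by
    refine Nat.eq_of_mul_eq_mul_left hprime.pos ?_
    rw [mul_left_comm, hc _ hk]
    have := Nat.add_one_mul_choose_eq (p - 1) j
    rw [hsucc] at this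
    rw [this, mul_comm]
  have h2 := congrArg (Nat.cast : ℕ → ZMod p) h1
  rw [choose_sub_one_residue (by omega), Nat.cast_mul] at h2
  rw [letterTerm, eulerSum, mul_one, pow_one, div_eq_iff (pow_ne_zero _ hk0),
    show 1 / 2 + 1 = 1 from rfl, pow_one, pow_succ, ← h2]
  ring

end Residues

/-! ### Finite Euler sums of coded words -/

/-- The code of an index. -/
def SignedIndex.code : SignedIndex → ℕ
  | pos s => 2 * (s - 1)
  | bar s => 2 * (s - 1) + 1

theorem SignedIndex.code_div_two_add_one (s : SignedIndex) : s.code / 2 + 1 = s.abs := by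
  rcases s with s | s <;> have := s.pos <;> simp only [code, abs] <;> omega

theorem SignedIndex.code_surjective : Function.Surjective SignedIndex.code := fun a => by
  rcases Nat.even_or_odd' a with ⟨k, rfl | rfl⟩
  · exact ⟨pos k.succPNat, by simp [code]⟩
  · exact ⟨bar k.succPNat, by simp [code]⟩

theorem SignedIndex.sgn_eq (s : SignedIndex) : s.sgn = (-1) ^ s.code := by
  rcases s with s | s <;> simp [code, sgn, pow_add, pow_mul]

theorem eulerPartialSum_eq (K : Type) [Field K] (s : List SignedIndex) (N : ℕ) :
    eulerPartialSum K s N = eulerSum K (s.map SignedIndex.code) N := by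
  induction s generalizing N with
  | nil => rfl
  | cons s t ih =>
    rw [eulerPartialSum, List.map_cons, eulerSum]
    refine Finset.sum_congr rfl fun n _ => ?_
    rw [ih, letterTerm, s.code_div_two_add_one, s.sgn_eq]
    push_cast
    rfl

/-- The finite Euler sum of a coded word. -/
noncomputable def wordZeta (w : List ℕ) : 𝒜 :=
  𝒜.of fun p => haveI := Fact.mk p.2; eulerSum (ZMod (p : ℕ)) w p

theorem zetaA_eq (s : List SignedIndex) : zetaA s = wordZeta (s.map SignedIndex.code) := by
  unfold zetaA wordZeta
  congr 1
  funext p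
  have := Fact.mk p.2
  exact eulerPartialSum_eq _ _ _

theorem intCast_mul_of (c : ℤ) (f : ∀ p : Nat.Primes, ZMod (p : ℕ)) :
    (c : 𝒜) * 𝒜.of f = 𝒜.of fun p => (c : ZMod (p : ℕ)) * f p := by
  refine Eq.trans ?_ (map_mul (Ideal.Quotient.mk finSuppIdeal)
    (fun p : Nat.Primes => (c : ZMod (p : ℕ))) f).symm
  congr 1

theorem sum_map_wordZeta (W : List (List ℕ)) :
    (W.map wordZeta).sum = 𝒜.of fun p => haveI := Fact.mk p.2;
      (W.map fun w => eulerSum (ZMod (p : ℕ)) w p).sum := by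
  induction W with
  | nil => exact (map_zero (Ideal.Quotient.mk finSuppIdeal)).symm
  | cons w W ih =>
    rw [List.map_cons, List.sum_cons, ih]
    exact (map_add (Ideal.Quotient.mk finSuppIdeal) _ _).symm

theorem wordZeta_mul (u v : List ℕ) :
    wordZeta u * wordZeta v = ((stuffle u v).map wordZeta).sum := by
  rw [sum_map_wordZeta]
  refine (map_mul (Ideal.Quotient.mk finSuppIdeal) _ _).symm.trans ?_
  refine congrArg 𝒜.of (funext fun p => ?_)
  have := Fact.mk p.2
  exact (sum_stuffle u v p).symm

theorem wordZeta_shuffle (u v : List ℕ) :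
    ((shuffleWords u v).map wordZeta).sum =
      (-1 : ℤ) ^ reflExponent u • wordZeta (u.reverse ++ v) := by
  rw [sum_map_wordZeta, zsmul_eq_mul, wordZeta, intCast_mul_of]
  refine 𝒜.of_eq_of_finite _ (finite_primes_dvd 2 two_ne_zero) fun p hp => ?_
  have := Fact.mk p.2
  have hodd : Odd (p : ℕ) := p.2.odd_of_ne_two fun e => hp (by simp [e])
  rw [sum_shuffleWords (fun m h0 h => natCast_ne_zero_of_lt h0 h) (ZMod.natCast_self _) hodd]
  push_cast
  rfl

theorem sum_flatMap_stuffle (z : List ℕ) (W : List (List ℕ)) :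
    ((W.flatMap (stuffle z)).map wordZeta).sum = wordZeta z * (W.map wordZeta).sum := by
  induction W with
  | nil => simp
  | cons w W ih => simp [ih, mul_add, wordZeta_mul]

theorem prod_map_wordZeta (W : List (List ℕ)) :
    (W.map wordZeta).prod = ((stuffleProd W).map wordZeta).sum := by
  induction W with
  | nil =>
    simp only [stuffleProd, List.map_nil, List.map_cons, List.prod_nil, List.sum_cons,
      List.sum_nil, add_zero]
    exact (map_one (Ideal.Quotient.mk finSuppIdeal)).symm
  | cons w W ih => rw [stuffleProd, sum_flatMap_stuffle, List.map_cons, List.prod_cons, ih]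

/-! ### Weights -/

/-- The weight of a coded word. -/
def wordWeight (w : List ℕ) : ℕ := (w.map fun a => a / 2 + 1).sum

theorem wordWeight_cons (a : ℕ) (w : List ℕ) :
    wordWeight (a :: w) = a / 2 + 1 + wordWeight w := by simp [wordWeight]

theorem weight_eq (s : List SignedIndex) : weight s = wordWeight (s.map SignedIndex.code) := by
  simp only [weight, wordWeight, List.map_map, Function.comp_def, SignedIndex.code_div_two_add_one]

theorem mem_words {n : ℕ} {w : List ℕ} (h : wordWeight w = n) : w ∈ words n := by
  induction n generalizing w with
  | zero =>
    rcases w with _ | ⟨a, w⟩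
    · simp [words]
    · rw [wordWeight_cons] at h; omega
  | succ n ih =>
    rw [words, List.mem_flatMap]
    rcases w with _ | ⟨a, w⟩
    · simp [wordWeight] at h
    rw [wordWeight_cons] at h
    rcases Nat.lt_or_ge a 2 with ha | ha
    · refine ⟨w, ih (by omega), ?_⟩
      rcases w with _ | ⟨b, w⟩ <;> interval_cases a <;> simp
    · refine ⟨(a - 2) :: w, ih (by rw [wordWeight_cons]; omega), ?_⟩
      simp [Nat.sub_add_cancel ha]

theorem FES_eq_span (n : ℕ) :
    FES n = Submodule.span ℚ {x | ∃ w : List ℕ, wordWeight w = n ∧ x = wordZeta w} := by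
  unfold FES
  congr 1
  ext x
  constructor
  · rintro ⟨s, hs, rfl⟩
    exact ⟨_, (weight_eq s).symm.trans hs, zetaA_eq s⟩
  · rintro ⟨w, hw, rfl⟩
    obtain ⟨s, rfl⟩ := SignedIndex.code_surjective.list_map w
    exact ⟨s, (weight_eq s).trans hw, (zetaA_eq s).symm⟩

theorem wordZeta_mem_FES {w : List ℕ} {n : ℕ} (h : wordWeight w = n) : wordZeta w ∈ FES n := by
  rw [FES_eq_span]
  exact Submodule.subset_span ⟨w, h, rfl⟩

theorem wordWeight_of_mem_stuffle {u v w : List ℕ} (h : w ∈ stuffle u v) :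
    wordWeight w = wordWeight u + wordWeight v := by
  induction u generalizing v w with
  | nil =>
    rw [stuffle, List.mem_singleton] at h
    simp [h, wordWeight]
  | cons a u ih =>
    induction v generalizing w with
    | nil =>
      rw [stuffle, stuffleAux, List.mem_singleton] at h
      simp [h, wordWeight]
    | cons b v ihv =>
      have h' : w ∈ (stuffle u (b :: v)).map (a :: ·) ++ ((stuffle (a :: u) v).map (b :: ·) ++
        (stuffle u v).map (mergeLetter a b :: ·)) := h
      simp only [List.mem_append, List.mem_map] at h'
      rcases h' with ⟨w, hw, rfl⟩ | ⟨w, hw, rfl⟩ | ⟨w, hw, rfl⟩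
      · have := ih hw
        simp only [wordWeight_cons] at this ⊢
        omega
      · have := ihv hw
        simp only [wordWeight_cons] at this ⊢
        omega
      · have := ih hw
        simp only [wordWeight_cons, mergeLetter] at this ⊢
        omega

theorem mul_mem_FES {x y : 𝒜} {m n k : ℕ} (hx : x ∈ FES m) (hy : y ∈ FES n) (hk : m + n = k) :
    x * y ∈ FES k := by
  have h : FES m * FES n ≤ FES k := by
    rw [FES_eq_span m, FES_eq_span n, Submodule.span_mul_span, Submodule.span_le]
    rintro _ ⟨_, ⟨u, hu, rfl⟩, _, ⟨v, hv, rfl⟩, rfl⟩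
    change wordZeta u * wordZeta v ∈ FES k
    rw [wordZeta_mul]
    refine list_sum_mem fun x hx => ?_
    obtain ⟨w, hw, rfl⟩ := List.mem_map.1 hx
    exact wordZeta_mem_FES (by rw [wordWeight_of_mem_stuffle hw, hu, hv, hk])
  exact h (Submodule.mul_mem_mul hx hy)

theorem pow_mem_FES {x : 𝒜} (hx : x ∈ FES 1) {n : ℕ} (hn : n ≠ 0) : x ^ n ∈ FES n := by
  obtain ⟨n, rfl⟩ := Nat.exists_eq_succ_of_ne_zero hn
  induction n with
  | zero => simpa using hx
  | succ n ih => rw [pow_succ]; exact mul_mem_FES (ih n.succ_ne_zero) hx rfl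

theorem FES_le_of_checkSpan {n : ℕ} {T : List (List (List ℕ))}
    {R : List (List ℕ × List ℕ × List ℕ)} (h : checkSpan n T R = true) {V : Submodule ℚ 𝒜}
    (hV : ∀ W ∈ T, (W.map wordZeta).prod ∈ V) : FES n ≤ V := by
  rw [FES_eq_span, Submodule.span_le]
  rintro _ ⟨w, hw, rfl⟩
  have hsum : ∀ W : List (List ℕ), (W.map fun w => V.mkQ (wordZeta w)).sum =
      V.mkQ (W.map wordZeta).sum := fun W => by
    rw [map_list_sum, List.map_map, Function.comp_def]
  have := eq_zero_of_checkSpan (fun w => V.mkQ (wordZeta w)) h (fun W hW => by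
      rw [hsum, ← prod_map_wordZeta]
      exact (Submodule.Quotient.mk_eq_zero V).2 (hV W hW))
    (fun z u v => by
      rw [hsum, hsum, ← map_zsmul, sum_flatMap_stuffle, wordZeta_shuffle, mul_smul_comm,
        wordZeta_mul])
    (mem_words hw)
  exact (Submodule.Quotient.mk_eq_zero V).1 this

/-! ### The generators -/

theorem wordZeta_bar_one : wordZeta [1] = (-2 : ℤ) * q₂ := by
  rw [q₂, intCast_mul_of]
  refine 𝒜.of_eq_of_finite _ (finite_primes_dvd 2 two_ne_zero) fun p hp => ?_
  have := Fact.mk p.2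
  have h3 : 3 ≤ (p : ℕ) := by
    have h2 := p.2.two_le
    rcases h2.eq_or_lt with h | h
    · exact absurd (by simp [← h]) hp
    · exact h
  rw [if_pos h3, eulerSum_bar_one h3]
  push_cast
  rfl

theorem wordZeta_one_sub_one {w : ℕ} (hw : 2 ≤ w) :
    wordZeta [0, 2 * (w - 2)] = (-w : ℤ) * β w := by
  rw [β, intCast_mul_of]
  refine 𝒜.of_eq_of_finite _ (finite_primes_dvd w.factorial w.factorial_ne_zero) fun p hp => ?_
  have := Fact.mk p.2
  have hp : w < (p : ℕ) := by
    by_contra hle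
    exact hp ((p.2.dvd_factorial).2 (not_lt.1 hle))
  have hw0 : (w : ZMod (p : ℕ)) ≠ 0 := natCast_ne_zero_of_lt (by omega) hp
  have h := (bernoulli_hasResidue (p := p) (n := p - w) (by omega)).mul (.inv_natCast hw0)
  rw [if_pos hp, eulerSum_one_sub_one hw hp, div_eq_mul_inv, h.2]
  push_cast
  field_simp

/-! ### The relations used

Triples `(z, u, v)` standing for the shuffle relation of `u` and `v` multiplied by `z`, in an order
which keeps the elimination sparse. -/

def relations2 : List (List ℕ × List ℕ × List ℕ) :=
  [([],[0],[0]),([],[3],[]),([],[0],[1]),([],[1],[1]),([0],[0],[])]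

def relations3 : List (List ℕ × List ℕ × List ℕ) :=
  [([],[0],[0,0]),([],[1],[1,1]),([],[4],[]),([],[0],[0,1]),([],[0],[1,1]),([],[0],[2]),
   ([],[1],[1,0]),([],[2],[1]),([],[0,3],[]),([],[1,2],[]),([],[0],[1,0]),([],[0],[3]),
   ([0],[3],[]),([0,1],[0],[]),([1],[0],[0]),([1],[0],[1])]

def relations4 : List (List ℕ × List ℕ × List ℕ) :=
  [([],[0],[0,0,0]),([],[0,3,0],[]),([],[1,3,1],[]),([],[7],[]),([],[0],[0,0,1]),([],[0],[0,1,1]),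
   ([],[0],[0,2]),([],[0],[1,1,0]),([],[0],[2,0]),([],[1],[1,0,0]),([],[1,1],[1,0]),
   ([],[1,1],[1,1]),([],[2],[2]),([],[0,0,1,0],[]),([],[0,0,3],[]),([],[0,1,0,1],[]),
   ([],[0,1,1,1],[]),([],[0,1,2],[]),([],[0,1,3],[]),([],[0,2,1],[]),([],[0,3,1],[]),([],[0,4],[]),
   ([],[0,5],[]),([],[1,0,1,1],[]),([],[1,0,2],[]),([],[1,0,3],[]),([],[1,1,2],[]),([],[1,1,3],[]),
   ([],[1,4],[]),([],[1,5],[]),([],[2,3],[]),([3],[3],[]),([],[0],[0,1,0]),([],[0],[0,3]),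
   ([],[0],[1,1,1]),([],[0],[1,3]),([],[0],[2,1]),([],[2],[3]),([],[3],[3]),([],[3,0],[0]),
   ([0],[4],[]),([],[1],[1,3]),([0],[0],[0,0]),([0,0],[0],[0]),([0,1],[3],[]),([0],[1],[1,1]),
   ([0],[0,3],[]),([0,1],[0],[0]),([0],[0,0,1],[]),([0],[1,2],[]),([1],[0],[0,1])]

def relations5 : List (List ℕ × List ℕ × List ℕ) :=
  [([],[0],[0,0,0,0]),([],[1,0,0,1],[1]),([],[0,1,0,1,0],[]),([],[0,4,0],[]),([],[1,1,0,1,1],[]),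
   ([],[1,4,1],[]),([],[2,0,2],[]),([],[3,0,3],[]),([],[8],[]),([],[0],[0,0,0,1]),
   ([],[0],[0,0,1,1]),([],[0],[0,0,2]),([],[0],[0,1,1,0]),([],[0],[0,2,0]),([],[0],[1,1,0,0]),
   ([],[0],[2,0,0]),([],[1],[1,0,0,0]),([],[1],[1,1,1,1]),([],[1,1],[1,0,1]),([],[2],[4]),
   ([],[1,0,1,0],[0]),([],[1,2,1],[1]),([],[4,0],[0]),([],[0,0,0,1,0],[]),([],[0,0,0,3],[]),
   ([],[0,0,1,0,1],[]),([],[0,0,1,1,1],[]),([],[0,0,1,2],[]),([],[0,0,1,3],[]),([],[0,0,2,1],[]),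
   ([],[0,0,3,0],[]),([],[0,0,3,1],[]),([],[0,0,4],[]),([],[0,0,5],[]),([],[0,1,0,0,1],[]),
   ([],[0,1,0,1,1],[]),([],[0,1,0,2],[]),([],[0,1,0,3],[]),([],[0,1,1,0,1],[]),([],[0,1,1,1,1],[]),
   ([],[0,1,1,2],[]),([],[0,1,1,3],[]),([],[0,1,2,0],[]),([],[0,1,2,1],[]),([],[0,1,3,0],[]),
   ([],[0,1,3,1],[]),([],[0,1,4],[]),([],[0,1,5],[]),([],[0,2,0,1],[]),([],[0,2,1,1],[]),
   ([],[0,2,2],[]),([],[0,2,3],[]),([],[0,3,0,1],[]),([],[0,3,1,1],[]),([],[0,3,2],[]),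
   ([],[0,3,3],[]),([],[0,4,1],[]),([],[0,5,1],[]),([],[0,6],[]),([],[0,7],[]),([],[1,0,0,1,1],[]),
   ([],[1,0,0,2],[]),([],[1,0,0,3],[]),([],[1,0,1,2],[]),([],[1,0,1,3],[]),([],[1,0,3,1],[]),
   ([],[1,0,4],[]),([],[1,0,5],[]),([],[1,1,0,2],[]),([],[1,1,0,3],[]),([],[1,1,1,2],[]),
   ([],[1,1,1,3],[]),([],[1,1,2,1],[]),([],[1,1,3,1],[]),([],[1,1,4],[]),([],[1,1,5],[]),
   ([],[1,2,2],[]),([],[1,2,3],[]),([],[1,3,2],[]),([],[1,3,3],[]),([],[1,6],[]),([],[1,7],[]),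
   ([],[2,0,3],[]),([],[2,1,3],[]),([],[2,4],[]),([],[2,5],[]),([],[3,4],[]),([],[3,5],[]),
   ([],[0],[0,0,1,0]),([],[0],[0,0,3]),([],[0],[0,1,1,1]),([],[0],[0,1,3]),([],[0],[0,2,1]),
   ([],[0],[1,1,2]),([],[0],[2,0,1]),([],[1,1],[1,0,0]),([0],[7],[]),([3],[4],[]),
   ([],[0],[0,1,0,0]),([],[0],[0,1,2]),([],[0],[0,3,0]),([],[0],[0,3,1]),([],[0],[0,5]),
   ([],[0],[1,0,1,1]),([],[0],[1,0,3]),([],[0],[1,1,1,0]),([],[0],[1,1,3]),([],[0],[1,5]),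
   ([],[0],[2,3]),([],[0],[3,1,1]),([],[0],[4,1]),([],[1],[0,1,0,1]),([],[1],[1,0,3]),
   ([],[1,1],[1,3]),([],[2],[1,3]),([],[2],[5]),([],[3],[3,0]),([],[3],[5]),([],[0],[1,0,2]),
   ([],[0],[1,4]),([],[0],[3,0,0]),([],[0],[3,2]),([],[0],[5,0]),([],[1],[0,1,3]),([],[1],[0,3,1]),
   ([],[1],[1,3,1]),([],[1],[1,5]),([],[3],[3,1]),([0],[0,4],[]),([3],[0,3],[]),([0],[1,3,1],[]),
   ([3],[2],[1]),([0],[0],[0,2]),([0],[0,3,0],[]),([0],[1,0,3],[]),([0],[1,4],[]),([0],[1,5],[]),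
   ([3],[1,2],[]),([0],[0,0,3],[]),([3],[1],[1,1]),([0],[0,0,0,1],[]),([0],[0,1,0,1],[]),
   ([0],[0,1,3],[]),([0],[0],[0,0,1]),([0],[0,3,1],[]),([1],[2],[3]),([0],[1,1,2],[]),
   ([0],[3],[3]),([3],[0],[0,0]),([1],[2],[1,1]),([0],[0],[0,3]),([0],[1,1],[1,0]),
   ([1],[1],[1,0,1]),([1],[1],[1,1,1]),([2],[0],[0,1]),([0],[0,1,1,1],[]),([1],[0],[1,0,1])]

def relations6 : List (List ℕ × List ℕ × List ℕ) :=
  [([],[0],[0,0,0,0,0]),([],[0,0,3,0,0],[]),([],[0,1,3,1,0],[]),([],[0,7,0],[]),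
   ([],[1,0,3,0,1],[]),([],[1,1,3,1,1],[]),([],[1,7,1],[]),([],[2,3,2],[]),([],[3,3,3],[]),
   ([],[11],[]),([],[0],[0,0,0,0,1]),([],[0],[0,0,0,1,1]),([],[0],[0,0,0,2]),([],[0],[0,0,1,1,0]),
   ([],[0],[0,0,2,0]),([],[0],[0,1,1,0,0]),([],[0],[0,2,0,0]),([],[0],[1,1,0,0,0]),
   ([],[0],[2,0,0,0]),([],[1],[1,0,0,0,0]),([],[1,0,0,1],[1,0]),([],[0,0,0,0,1,0],[]),
   ([],[0,0,0,0,3],[]),([],[0,0,0,1,0,0],[]),([],[0,0,0,1,0,1],[]),([],[0,0,0,1,1,1],[]),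
   ([],[0,0,0,1,2],[]),([],[0,0,0,1,3],[]),([],[0,0,0,2,1],[]),([],[0,0,0,3,0],[]),
   ([],[0,0,0,3,1],[]),([],[0,0,0,4],[]),([],[0,0,0,5],[]),([],[0,0,1,0,0,1],[]),
   ([],[0,0,1,0,1,0],[]),([],[0,0,1,0,1,1],[]),([],[0,0,1,0,2],[]),([],[0,0,1,0,3],[]),
   ([],[0,0,1,1,0,1],[]),([],[0,0,1,1,1,0],[]),([],[0,0,1,1,1,1],[]),([],[0,0,1,1,2],[]),
   ([],[0,0,1,1,3],[]),([],[0,0,1,2,0],[]),([],[0,0,1,2,1],[]),([],[0,0,1,3,0],[]),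
   ([],[0,0,1,3,1],[]),([],[0,0,1,4],[]),([],[0,0,1,5],[]),([],[0,0,2,0,1],[]),([],[0,0,2,1,0],[]),
   ([],[0,0,2,1,1],[]),([],[0,0,2,2],[]),([],[0,0,2,3],[]),([],[0,0,3,0,1],[]),([],[0,0,3,1,0],[]),
   ([],[0,0,3,1,1],[]),([],[0,0,3,2],[]),([],[0,0,3,3],[]),([],[0,0,4,0],[]),([],[0,0,4,1],[]),
   ([],[0,0,5,0],[]),([],[0,0,5,1],[]),([],[0,0,6],[]),([],[0,0,7],[]),([],[0,1,0,0,0,1],[]),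
   ([],[0,1,0,0,1,1],[]),([],[0,1,0,0,2],[]),([],[0,1,0,0,3],[]),([],[0,1,0,1,0,1],[]),
   ([],[0,1,0,1,1,0],[]),([],[0,1,0,1,1,1],[]),([],[0,1,0,1,2],[]),([],[0,1,0,1,3],[]),
   ([],[0,1,0,2,0],[]),([],[0,1,0,2,1],[]),([],[0,1,0,3,0],[]),([],[0,1,0,3,1],[]),
   ([],[0,1,0,4],[]),([],[0,1,0,5],[]),([],[0,1,1,0,0,1],[]),([],[0,1,1,0,1,1],[]),
   ([],[0,1,1,0,2],[]),([],[0,1,1,0,3],[]),([],[0,1,1,1,0,1],[]),([],[0,1,1,1,1,1],[]),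
   ([],[0,1,1,1,2],[]),([],[0,1,1,1,3],[]),([],[0,1,1,2,0],[]),([],[0,1,1,2,1],[]),
   ([],[0,1,1,3,0],[]),([],[0,1,1,3,1],[]),([],[0,1,1,4],[]),([],[0,1,1,5],[]),([],[0,1,2,0,1],[]),
   ([],[0,1,2,1,1],[]),([],[0,1,2,2],[]),([],[0,1,2,3],[]),([],[0,1,3,0,1],[]),([],[0,1,3,1,1],[]),
   ([],[0,1,3,2],[]),([],[0,1,3,3],[]),([],[0,1,4,0],[]),([],[0,1,4,1],[]),([],[0,1,5,0],[]),
   ([],[0,1,5,1],[]),([],[0,1,6],[]),([],[0,1,7],[]),([],[0,2,0,0,1],[]),([],[0,2,0,1,1],[]),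
   ([],[0,2,0,2],[]),([],[0,2,0,3],[]),([],[0,2,1,0,1],[]),([],[0,2,1,1,1],[]),([],[0,2,1,2],[]),
   ([],[0,2,1,3],[]),([],[0,2,2,1],[]),([],[0,2,3,0],[]),([],[0,2,3,1],[]),([],[0,2,4],[]),
   ([],[0,2,5],[]),([],[0,3,0,0,1],[]),([],[0,3,0,1,1],[]),([],[0,3,0,2],[]),([],[0,3,0,3],[]),
   ([],[0,3,1,0,1],[]),([],[0,3,1,1,1],[]),([],[0,3,1,2],[]),([],[0,3,1,3],[]),([],[0,3,2,1],[]),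
   ([],[0,3,3,1],[]),([],[0,3,4],[]),([],[0,3,5],[]),([],[0,4,0,1],[]),([],[0,4,1,1],[]),
   ([],[0,4,2],[]),([],[0,4,3],[]),([],[0,5,0,1],[]),([],[0,5,1,1],[]),([],[0,5,2],[]),
   ([],[0,5,3],[]),([],[0,6,1],[]),([],[0,7,1],[]),([],[0,8],[]),([],[0,9],[]),
   ([],[1,0,0,0,1,1],[]),([],[1,0,0,0,2],[]),([],[1,0,0,0,3],[]),([],[1,0,0,1,0,1],[]),
   ([],[1,0,0,1,1,1],[]),([],[1,0,0,1,2],[]),([],[1,0,0,1,3],[]),([],[1,0,0,2,1],[]),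
   ([],[1,0,0,3,1],[]),([],[1,0,0,4],[]),([],[1,0,0,5],[]),([],[1,0,1,0,1,1],[]),
   ([],[1,0,1,0,2],[]),([],[1,0,1,0,3],[]),([],[1,0,1,1,1,1],[]),([],[1,0,1,1,2],[]),
   ([],[1,0,1,1,3],[]),([],[1,0,1,2,1],[]),([],[1,0,1,3,1],[]),([],[1,0,1,4],[]),([],[1,0,1,5],[]),
   ([],[1,0,2,1,1],[]),([],[1,0,2,2],[]),([],[1,0,2,3],[]),([],[1,0,3,1,1],[]),([],[1,0,3,2],[]),
   ([],[1,0,3,3],[]),([],[1,0,4,1],[]),([],[1,0,5,1],[]),([],[1,0,6],[]),([],[1,0,7],[]),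
   ([],[1,1,0,0,2],[]),([],[1,1,0,0,3],[]),([],[1,1,0,1,1,1],[]),([],[1,1,0,1,2],[]),
   ([],[1,1,0,1,3],[]),([],[1,1,0,2,1],[]),([],[1,1,0,3,1],[]),([],[1,1,0,4],[]),([],[1,1,0,5],[]),
   ([],[1,1,1,0,2],[]),([],[1,1,1,0,3],[]),([],[1,1,1,1,2],[]),([],[1,1,1,1,3],[]),
   ([],[1,1,1,2,1],[]),([],[1,1,1,3,1],[]),([],[1,1,1,4],[]),([],[1,1,1,5],[]),([],[1,1,2,2],[]),
   ([],[1,1,2,3],[]),([],[1,1,3,2],[]),([],[1,1,3,3],[]),([],[1,1,4,1],[]),([],[1,1,5,1],[]),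
   ([],[1,1,6],[]),([],[1,1,7],[]),([],[1,2,0,2],[]),([],[1,2,0,3],[]),([],[1,2,1,2],[]),
   ([],[1,2,1,3],[]),([],[1,2,3,1],[]),([],[1,2,4],[]),([],[1,2,5],[]),([],[1,3,0,2],[]),
   ([],[1,3,0,3],[]),([],[1,3,1,2],[]),([],[1,3,1,3],[]),([],[1,3,4],[]),([],[1,3,5],[]),
   ([],[1,4,2],[]),([],[1,4,3],[]),([],[1,5,2],[]),([],[1,5,3],[]),([],[1,8],[]),([],[1,9],[]),
   ([],[2,0,0,3],[]),([],[2,0,1,2],[]),([],[2,0,1,3],[]),([],[2,0,4],[]),([],[2,0,5],[]),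
   ([],[2,1,0,3],[]),([],[2,1,1,3],[]),([],[2,1,4],[]),([],[2,1,5],[]),([],[2,2,3],[]),
   ([],[2,3,3],[]),([],[2,6],[]),([],[2,7],[]),([],[3,0,1,3],[]),([],[3,0,4],[]),([],[3,0,5],[]),
   ([],[3,1,4],[]),([],[3,1,5],[]),([],[3,6],[]),([],[3,7],[]),([],[4,5],[]),([],[0],[0,0,0,1,0]),
   ([],[0],[0,0,0,3]),([],[0],[0,0,1,0,1]),([],[0],[0,0,1,1,1]),([],[0],[0,0,1,3]),
   ([],[0],[0,0,2,1]),([],[0],[0,0,3,1]),([],[0],[0,0,4]),([],[0],[0,1,0,1,0]),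
   ([],[0],[0,1,1,0,1]),([],[0],[0,1,1,1,1]),([],[0],[0,1,1,2]),([],[0],[0,2,0,1]),
   ([],[0],[0,2,2]),([],[0],[0,4,0]),([],[0],[1,1,0,1,1]),([],[0],[1,1,0,2]),([],[0],[2,0,2]),
   ([],[1,1],[1,0,0,1]),([],[1,1],[1,0,1,0]),([],[2],[4,0]),([],[2],[6]),([0],[8],[]),([3],[7],[]),
   ([],[0],[0,0,1,0,0]),([],[0],[0,0,1,2]),([],[0],[0,0,3,0]),([],[0],[0,0,5]),
   ([],[0],[0,1,0,0,1]),([],[0],[0,1,0,1,1]),([],[0],[0,1,0,3]),([],[0],[0,1,1,1,0]),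
   ([],[0],[0,1,1,3]),([],[0],[0,1,2,1]),([],[0],[0,1,3,1]),([],[0],[0,1,5]),([],[0],[0,2,1,0]),
   ([],[0],[0,2,1,1]),([],[0],[0,2,3]),([],[0],[0,3,1,1]),([],[0],[0,3,3]),([],[0],[0,4,1]),
   ([],[0],[0,6]),([],[0],[1,0,1,0,1]),([],[0],[1,0,1,1,1]),([],[0],[1,0,1,2]),([],[0],[1,1,0,3]),
   ([],[0],[1,1,1,1,1]),([],[0],[1,1,1,3]),([],[0],[1,1,3,1]),([],[0],[1,1,4]),([],[0],[1,3,2]),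
   ([],[0],[2,0,3]),([],[0],[2,1,1,1]),([],[0],[2,1,3]),([],[0],[2,2,1]),([],[0],[2,4]),
   ([],[0],[4,0,1]),([],[1],[1,0,0,3]),([],[1],[1,0,1,1,1]),([],[1],[1,0,2,1]),
   ([],[1,0],[1,0,1,1]),([],[5],[5]),([],[1,1,0,1,1],[1]),([],[1,3,1,0],[0]),([],[1,4,1],[1]),
   ([],[3,0,3],[1]),([],[0],[0,1,0,2]),([],[0],[0,1,2,0]),([],[0],[0,1,4]),([],[0],[0,3,2]),
   ([],[0],[0,5,0]),([],[0],[0,7]),([],[0],[1,0,0,3]),([],[0],[1,0,1,3]),([],[0],[1,0,2,1]),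
   ([],[0],[1,0,5]),([],[0],[1,1,1,0,0]),([],[0],[1,1,1,2]),([],[0],[1,1,3,0]),([],[0],[1,1,5]),
   ([],[0],[1,2,3]),([],[0],[1,3,3]),([],[0],[1,4,1]),([],[0],[1,7]),([],[0],[2,0,0,1]),
   ([],[0],[2,1,2]),([],[0],[2,3,0]),([],[0],[2,5]),([],[0],[3,0,1,1]),([],[0],[3,0,3]),
   ([],[0],[3,1,3]),([],[0],[3,3,1]),([],[0],[3,5]),([],[0],[4,3]),([],[0],[5,1,1]),([],[0],[6,1]),
   ([],[1],[0,1,0,3]),([],[1],[0,3,0,1]),([],[1],[1,0,5]),([],[1],[1,1,1,3]),([],[1,1],[1,3,0]),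
   ([],[1,1],[2,0,0]),([],[1,1],[3,1,0]),([],[2],[5,1]),([],[2],[7]),([],[3],[3,0,0]),
   ([],[3],[3,2]),([],[3],[5,0]),([],[3],[7]),([],[1,1,1],[1,1,1]),([],[1,2],[1,2]),([],[7,0],[0]),
   ([0],[0,4,0],[]),([],[0],[1,0,0,2]),([],[0],[1,0,4]),([],[0],[1,2,2]),([],[0],[3,0,0,0]),
   ([],[0],[3,0,2]),([],[0],[3,4]),([],[0],[5,0,0]),([],[1],[0,0,1,3]),([],[1],[0,0,3,1]),
   ([],[1],[0,1,1,2]),([],[1],[0,3,3]),([],[1],[0,5,1]),([],[1],[1,3,2]),([],[1],[1,7]),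
   ([],[1],[3,5]),([],[2],[1,1,2]),([],[2],[1,3,0]),([],[3,1],[3,1]),([0],[0],[0,0,0,0]),
   ([0],[0,7],[]),([0],[2,0,2],[]),([0],[3,0,3],[]),([0,1],[7],[]),([],[0],[0,5,1]),
   ([],[0],[1,0,3,1]),([],[0],[1,1,2,1]),([],[0],[3,1,0,1]),([],[0,1],[3,0,0]),([],[1,1],[1,0,3]),
   ([],[2],[5,0]),([],[3],[3,1,1]),([],[3],[5,1]),([],[3,0],[5]),([0],[0,6],[]),([3],[2,3],[]),
   ([],[1],[0,1,0,1,1]),([],[1],[0,1,5]),([],[1,1],[1,3,1]),([],[2],[3,1,1]),([0],[2],[4]),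
   ([2],[2],[2]),([],[1,1],[1,0,2]),([],[3,0],[3,1]),([0],[3,5],[]),([2],[0],[0,0,0]),
   ([],[0,1],[5,0]),([],[3],[3,0,1]),([],[3],[3,1,0]),([0],[0,0,5],[]),([0],[1,1,0,1,1],[]),
   ([3],[1,5],[]),([3],[0,0,3],[]),([3],[1,1,3],[]),([0],[0,1,5],[]),([0],[0,0,0,0,1],[]),
   ([0],[0,0,0,3],[]),([0],[0,0,1,3],[]),([0],[0,1,3,1],[]),([0],[1,1,5],[]),([0],[1,3,3],[]),
   ([0],[1,6],[]),([0],[0],[0,0,0,1]),([0],[0],[0,0,1,1]),([0],[0,1,0,1,0],[]),([0],[0,1,0,3],[]),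
   ([0],[1,0,0,3],[]),([0],[1,2,3],[]),([0],[0,1,0,0,1],[]),([0],[0,2,1,1],[]),([0],[1,0,1,3],[]),
   ([0],[0,0,3,1],[]),([3],[1,0,3],[]),([0],[3],[5]),([0],[1,4,1],[]),([3],[1,4],[]),
   ([0],[0,1,1,1,1],[]),([3],[1,3,1],[]),([0],[0,1,1,2],[]),([0],[1,1,0,3],[]),([0],[2,1,3],[]),
   ([1],[3],[5]),([2],[0],[1,3]),([0],[0],[7]),([0],[0,3,3],[]),([0],[1,1,3,1],[]),([1],[2],[5]),
   ([0],[0,1,1,3],[]),([],[0],[1,6]),([0],[1,1,2,1],[]),([0],[0,1,2,1],[]),([0],[1,1,4],[]),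
   ([3],[0,1,2],[]),([0],[1,0,5],[]),([1],[0],[1,3,1]),([0],[0],[0,1,1,1]),([0],[1,3,2],[]),
   ([3],[0,1,3],[]),([0],[1,1,1,3],[]),([2],[1],[1,3]),([0],[0],[2,3]),([1],[3],[3,1]),
   ([0],[0],[1,5]),([0],[1,0,3],[1]),([3],[0,2,1],[]),([0],[0],[0,5]),([0],[1,0,4],[]),
   ([0],[0],[1,3,1]),([1],[1],[0,5]),([2],[1],[1,0,1]),([0],[3,1,1],[0]),([1],[3],[3,0]),
   ([1],[1],[1,1,3]),([1],[1,1],[3,1]),([0],[1,0],[3,0]),([1],[3],[1,1,1]),([0],[0],[0,1,3]),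
   ([0],[0],[1,1,2]),([0],[3],[1,0,0]),([1],[0],[0,1,3]),([1],[1,1],[3,0]),([1],[0],[0,0,1,0]),
   ([1],[0],[0,1,0,1]),([1],[0],[0,1,1,1])]

def targets3 : List (List (List ℕ)) := [[[1], [1], [1]], [[0, 2]]]

def targets4 : List (List (List ℕ)) := [[[1], [1], [1], [1]], [[1], [0, 2]], [[0, 5]]]

def targets5 : List (List (List ℕ)) :=
  [[[1], [1], [1], [1], [1]], [[1], [1], [0, 2]], [[0, 6]], [[1, 2, 2]], [[1, 3, 2]]]

def targets6 : List (List (List ℕ)) :=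
  [[[1], [1], [1], [1], [1], [1]], [[1], [1], [1], [0, 2]], [[0, 2], [0, 2]], [[1], [0, 6]],
    [[1, 0, 2, 2]], [[1, 2, 2, 0]], [[1, 2, 0, 2]], [[1, 0, 0, 0, 2]]]

theorem checkSpan_three : checkSpan 3 targets3 relations3 = true := by decide +kernel

theorem checkSpan_four : checkSpan 4 targets4 relations4 = true := by decide +kernel

theorem checkSpan_five : checkSpan 5 targets5 relations5 = true := by decide +kernel

set_option maxRecDepth 10000 in
theorem checkSpan_six : checkSpan 6 targets6 relations6 = true := by decide +kernel

theorem intCast_mul_mem {V : Submodule ℚ 𝒜} (c : ℤ) {x : 𝒜} (h : x ∈ V) : (c : 𝒜) * x ∈ V := by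
  rw [← zsmul_eq_mul]
  exact zsmul_mem h c

theorem q₂_mem_FES : q₂ ∈ FES 1 := by
  have h : q₂ = (-2⁻¹ : ℚ) • wordZeta [1] := by
    rw [wordZeta_bar_one, ← zsmul_eq_mul, ← Int.cast_smul_eq_zsmul ℚ, smul_smul]
    norm_num
  rw [h]
  exact Submodule.smul_mem _ _ (wordZeta_mem_FES rfl)

theorem β_mem_FES {w : ℕ} (hw : 2 ≤ w) : β w ∈ FES w := by
  have h0 : (w : ℚ) ≠ 0 := by positivity
  have h : β w = (-(w : ℚ)⁻¹) • wordZeta [0, 2 * (w - 2)] := by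
    rw [wordZeta_one_sub_one hw, ← zsmul_eq_mul, ← Int.cast_smul_eq_zsmul ℚ, smul_smul]
    push_cast
    rw [neg_mul_neg, inv_mul_cancel₀ h0, one_smul]
  rw [h]
  refine Submodule.smul_mem _ _ (wordZeta_mem_FES ?_)
  simp only [wordWeight, List.map_cons, List.map_nil, List.sum_cons, List.sum_nil]
  omega

theorem zetaA_mem_FES {s : List SignedIndex} {n : ℕ} (h : weight s = n) : zetaA s ∈ FES n :=
  Submodule.subset_span ⟨s, h, rfl⟩

theorem wordZeta_one_two : wordZeta [0, 2] = (-3 : ℤ) * β 3 :=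
  wordZeta_one_sub_one (w := 3) (by norm_num)

theorem wordZeta_one_four : wordZeta [0, 6] = (-5 : ℤ) * β 5 :=
  wordZeta_one_sub_one (w := 5) (by norm_num)

open SignedIndex

theorem FES_one : FES 1 = Submodule.span ℚ {q₂} := by
  refine le_antisymm (FES_le_of_checkSpan (T := [[[1]]]) (R := [([], [0], [])])
    (by decide +kernel) ?_) ?_
  · simp only [List.forall_mem_singleton, List.map_cons, List.map_nil, List.prod_cons,
      List.prod_nil, mul_one, wordZeta_bar_one]
    exact intCast_mul_mem _ (Submodule.subset_span (by simp))
  · rw [Submodule.span_le, Set.singleton_subset_iff]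
    exact q₂_mem_FES

theorem FES_two : FES 2 = Submodule.span ℚ {q₂ ^ 2} := by
  refine le_antisymm (FES_le_of_checkSpan (T := [[[1], [1]]]) (R := relations2)
    (by decide +kernel) ?_) ?_
  · simp only [List.forall_mem_singleton, List.map_cons, List.map_nil, List.prod_cons,
      List.prod_nil, mul_one, wordZeta_bar_one]
    convert intCast_mul_mem 4 (Submodule.subset_span (Set.mem_singleton (q₂ ^ 2))) using 1
    push_cast
    ring
  · rw [Submodule.span_le, Set.singleton_subset_iff]
    exact pow_mem_FES q₂_mem_FES (by norm_num)

theorem FES_three : FES 3 = Submodule.span ℚ {q₂ ^ 3, β 3} := by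
  set V := Submodule.span ℚ {q₂ ^ 3, β 3} with hV
  refine le_antisymm (FES_le_of_checkSpan checkSpan_three ?_) ?_
  · have h1 : q₂ ^ 3 ∈ V := Submodule.subset_span (by simp)
    have h2 : β 3 ∈ V := Submodule.subset_span (by simp)
    simp only [targets3, List.forall_mem_cons, List.map_cons,
      List.map_nil, List.prod_cons, List.prod_nil, mul_one, wordZeta_bar_one, wordZeta_one_two]
    refine ⟨?_, intCast_mul_mem _ h2, List.forall_mem_nil _⟩
    convert intCast_mul_mem (-8) h1 using 1
    push_cast
    ring
  · simp only [hV, Submodule.span_le, Set.insert_subset_iff, Set.singleton_subset_iff,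
      SetLike.mem_coe]
    exact ⟨pow_mem_FES q₂_mem_FES (by norm_num), β_mem_FES (by norm_num)⟩

theorem FES_four : FES 4 = Submodule.span ℚ {q₂ ^ 4, q₂ * β 3, zetaA [pos 1, bar 3]} := by
  set V := Submodule.span ℚ {q₂ ^ 4, q₂ * β 3, zetaA [pos 1, bar 3]} with hV
  refine le_antisymm (FES_le_of_checkSpan checkSpan_four ?_) ?_
  · have h1 : q₂ ^ 4 ∈ V := Submodule.subset_span (by simp)
    have h2 : q₂ * β 3 ∈ V := Submodule.subset_span (by simp)
    have h3 : zetaA [pos 1, bar 3] ∈ V := Submodule.subset_span (by simp)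
    simp only [targets4, List.forall_mem_cons, List.map_cons,
      List.map_nil, List.prod_cons, List.prod_nil, mul_one, wordZeta_bar_one, wordZeta_one_two]
    refine ⟨?_, ?_, (zetaA_eq [pos 1, bar 3]).symm ▸ h3, List.forall_mem_nil _⟩
    · convert intCast_mul_mem 16 h1 using 1
      push_cast
      ring
    · convert intCast_mul_mem 6 h2 using 1
      push_cast
      ring
  · simp only [hV, Submodule.span_le, Set.insert_subset_iff, Set.singleton_subset_iff,
      SetLike.mem_coe]
    exact ⟨pow_mem_FES q₂_mem_FES (by norm_num),
      mul_mem_FES q₂_mem_FES (β_mem_FES (by norm_num)) rfl,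
      zetaA_mem_FES rfl⟩

theorem FES_five : FES 5 = Submodule.span ℚ {q₂ ^ 5, q₂ ^ 2 * β 3, β 5,
    zetaA [bar 1, pos 2, pos 2], zetaA [bar 1, bar 2, pos 2]} := by
  set V := Submodule.span ℚ {q₂ ^ 5, q₂ ^ 2 * β 3, β 5,
    zetaA [bar 1, pos 2, pos 2], zetaA [bar 1, bar 2, pos 2]} with hV
  refine le_antisymm (FES_le_of_checkSpan checkSpan_five ?_) ?_
  · have h1 : q₂ ^ 5 ∈ V := Submodule.subset_span (by simp)
    have h2 : q₂ ^ 2 * β 3 ∈ V := Submodule.subset_span (by simp)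
    have h3 : β 5 ∈ V := Submodule.subset_span (by simp)
    have h4 : zetaA [bar 1, pos 2, pos 2] ∈ V := Submodule.subset_span (by simp)
    have h5 : zetaA [bar 1, bar 2, pos 2] ∈ V := Submodule.subset_span (by simp)
    rw [zetaA_eq] at h4 h5
    simp only [targets5, List.forall_mem_cons, List.map_cons,
      List.map_nil, List.prod_cons, List.prod_nil, mul_one, wordZeta_bar_one, wordZeta_one_two,
      wordZeta_one_four]
    refine ⟨?_, ?_, intCast_mul_mem _ h3, h4, h5, List.forall_mem_nil _⟩
    · convert intCast_mul_mem (-32) h1 using 1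
      push_cast
      ring
    · convert intCast_mul_mem (-12) h2 using 1
      push_cast
      ring
  · simp only [hV, Submodule.span_le, Set.insert_subset_iff, Set.singleton_subset_iff,
      SetLike.mem_coe]
    exact ⟨pow_mem_FES q₂_mem_FES (by norm_num),
      mul_mem_FES (pow_mem_FES q₂_mem_FES (by norm_num)) (β_mem_FES (by norm_num)) rfl,
      β_mem_FES (by norm_num), zetaA_mem_FES rfl,
      zetaA_mem_FES rfl⟩

theorem FES_six : FES 6 = Submodule.span ℚ {q₂ ^ 6, q₂ ^ 3 * β 3, β 3 ^ 2, q₂ * β 5,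
    zetaA [bar 1, pos 1, pos 2, pos 2], zetaA [bar 1, pos 2, pos 2, pos 1],
    zetaA [bar 1, pos 2, pos 1, pos 2], zetaA [bar 1, pos 1, pos 1, pos 1, pos 2]} := by
  set V := Submodule.span ℚ {q₂ ^ 6, q₂ ^ 3 * β 3, β 3 ^ 2, q₂ * β 5,
    zetaA [bar 1, pos 1, pos 2, pos 2], zetaA [bar 1, pos 2, pos 2, pos 1],
    zetaA [bar 1, pos 2, pos 1, pos 2], zetaA [bar 1, pos 1, pos 1, pos 1, pos 2]} with hV
  refine le_antisymm (FES_le_of_checkSpan checkSpan_six ?_) ?_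
  · have h1 : q₂ ^ 6 ∈ V := Submodule.subset_span (by simp)
    have h2 : q₂ ^ 3 * β 3 ∈ V := Submodule.subset_span (by simp)
    have h3 : β 3 ^ 2 ∈ V := Submodule.subset_span (by simp)
    have h4 : q₂ * β 5 ∈ V := Submodule.subset_span (by simp)
    have h5 : zetaA [bar 1, pos 1, pos 2, pos 2] ∈ V := Submodule.subset_span (by simp)
    have h6 : zetaA [bar 1, pos 2, pos 2, pos 1] ∈ V := Submodule.subset_span (by simp)
    have h7 : zetaA [bar 1, pos 2, pos 1, pos 2] ∈ V := Submodule.subset_span (by simp)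
    have h8 : zetaA [bar 1, pos 1, pos 1, pos 1, pos 2] ∈ V := Submodule.subset_span (by simp)
    rw [zetaA_eq] at h5 h6 h7 h8
    simp only [targets6, List.forall_mem_cons, List.map_cons,
      List.map_nil, List.prod_cons, List.prod_nil, mul_one, wordZeta_bar_one, wordZeta_one_two,
      wordZeta_one_four]
    refine ⟨?_, ?_, ?_, ?_, h5, h6, h7, h8, List.forall_mem_nil _⟩
    · convert intCast_mul_mem 64 h1 using 1
      push_cast
      ring
    · convert intCast_mul_mem 24 h2 using 1
      push_cast
      ring
    · convert intCast_mul_mem 9 h3 using 1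
      push_cast
      ring
    · convert intCast_mul_mem 10 h4 using 1
      push_cast
      ring
  · simp only [hV, Submodule.span_le, Set.insert_subset_iff, Set.singleton_subset_iff,
      SetLike.mem_coe]
    refine ⟨pow_mem_FES q₂_mem_FES (by norm_num),
      mul_mem_FES (pow_mem_FES q₂_mem_FES (by norm_num)) (β_mem_FES (by norm_num)) rfl, ?_,
      mul_mem_FES q₂_mem_FES (β_mem_FES (by norm_num)) rfl,
      zetaA_mem_FES rfl, zetaA_mem_FES rfl,
      zetaA_mem_FES rfl,
      zetaA_mem_FES rfl⟩
    rw [sq]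
    exact mul_mem_FES (β_mem_FES (by norm_num)) (β_mem_FES (by norm_num)) rfl

end FiniteEuler

open FiniteEuler FiniteEuler.SignedIndex in
theorem mainTheorem5 :
    FES 1 = Submodule.span ℚ {q₂} ∧
    FES 2 = Submodule.span ℚ {q₂ ^ 2} ∧
    FES 3 = Submodule.span ℚ {q₂ ^ 3, β 3} ∧
    FES 4 = Submodule.span ℚ {q₂ ^ 4, q₂ * β 3, zetaA [pos 1, bar 3]} ∧
    FES 5 = Submodule.span ℚ {q₂ ^ 5, q₂ ^ 2 * β 3, β 5,
      zetaA [bar 1, pos 2, pos 2], zetaA [bar 1, bar 2, pos 2]} ∧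
    FES 6 = Submodule.span ℚ {q₂ ^ 6, q₂ ^ 3 * β 3, β 3 ^ 2, q₂ * β 5,
      zetaA [bar 1, pos 1, pos 2, pos 2], zetaA [bar 1, pos 2, pos 2, pos 1],
      zetaA [bar 1, pos 2, pos 1, pos 2], zetaA [bar 1, pos 1, pos 1, pos 1, pos 2]} :=
  ⟨FES_one, FES_two, FES_three, FES_four, FES_five, FES_six⟩
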